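/- Let $(N,h)$ be a compact oriented $3$-dimensional smooth Riemannian manifold (without boundary) of constant sectional curvature, and let $f:S^1\to(0,\infty)$ be a smooth function on the circle $S^1=\mathbb{R}/\mathbb{Z}$. Equip $M=S^1\times N$ with the warped product metric $g=dt^2\oplus f(t)^2\,h$. Let $\tau:M\to\mathbb{R}$ be a smooth function and consider the $3$-form $T=\tau\cdot\pi^*\mathrm{dvol}_{(N,h)}$, where $\mathrm{dvol}_{(N,h)}$ is the Riemannian volume form of $(N,h)$ and $\pi:S^1\times N\to N$ is the projection. Let $\alpha,\beta,\gamma_1,\gamma_2>0$ be real constants and suppose that $(M,g,T)$ satisfies the two equations $$0=3\gamma_1\,T-\gamma_2\,d\delta T,$$ $$0=\alpha G^g-\beta B^g+\gamma_1\Big(-6\,g^{*T}+\tfrac12\|T\|^2 g\Big)-\gamma_2\Big(-2\,g^{d*T}+\tfrac12\|\delta T\|^2 g\Big).$$ Then $T=0$. Here $*$ is the Hodge star of $g$ and $\delta=-*d\,*$ is the codifferential (the equations do not depend on the orientation of $M$); $G^g=\mathrm{ric}^g-\tfrac12R^g g$ is the Einstein tensor; $B^g$ is the Bach tensor, normalized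 as the $L^2$-gradient of $g\mapsto\int_M\|C^g\|^2\,\mathrm{dvol}_g$, that is, $B_{ij}=-4\big(\nabla^p\nabla^q C_{pijq}+\tfrac12\mathrm{ric}^{pq}C_{pijq}\big)$ with $C$ the Weyl tensor and the sign convention $\mathrm{ric}_{ij}=g^{pq}\mathrm{riem}_{pijq}$; the norm of a covariant tensor is $\|S\|^2=\sum_{i_1,\dots,i_k}S(E_{i_1},\dots,E_{i_k})^2$ for an orthonormal basis $(E_i)$; and for a $k$-form $\eta$, $k\ge1$, the symmetric tensor $g^\eta$ is $g^\eta(X,Y)=\langle X\lrcorner\eta,Y\lrcorner\eta\rangle_g$, where $\langle\omega,\omega'\rangle_g=\sum_{i_1<\dots<i_r}\omega(E_{i_1},\dots,E_{i_r})\,\omega'(E_{i_1},\dots,E_{i_r})$ on $r$-forms (so $g^\eta=\eta\otimes\eta$ for $k=1$). -/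

import Mathlib

open Set Filter Topology Manifold Bundle
open scoped ContDiff

/-! ### The circle `ℝ / ℤ` as a smooth manifold -/

/-- The smooth atlas on `S¹ = ℝ / ℤ` given by the local inverses of the projection `ℝ → ℝ / ℤ`. -/
noncomputable instance UnitAddCircle.chartedSpace : ChartedSpace ℝ UnitAddCircle :=
  (AddCircle.isLocalHomeomorph_coe (1 : ℝ)).chartedSpace Quotient.mk_surjective

/-- Every chart in the atlas is a local inverse of the projection. -/
theorem UnitAddCircle.symm_of_mem_atlas {e : OpenPartialHomeomorph UnitAddCircle ℝ}
    (he : e ∈ atlas ℝ UnitAddCircle) : ∀ s : ℝ, e.symm s = (s : UnitAddCircle) := by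
  obtain ⟨q, rfl⟩ := he
  intro s
  rw [chartAt_self_eq, OpenPartialHomeomorph.trans_refl, IsLocalHomeomorph.localInverseAt_symm]

/-- In a chart of the circle, the projection is a translation near every point. -/
theorem UnitAddCircle.chart_coe_eventually {e : OpenPartialHomeomorph UnitAddCircle ℝ}
    (he : e ∈ atlas ℝ UnitAddCircle) {s : ℝ} (hs : (s : UnitAddCircle) ∈ e.source) :
    ∀ᶠ r : ℝ in 𝓝 s, e (r : UnitAddCircle) = r + (e (s : UnitAddCircle) - s) := by
  have hcoe : Continuous (fun r : ℝ => (r : UnitAddCircle)) := AddCircle.continuous_mk' 1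
  have hsrc : ∀ᶠ r : ℝ in 𝓝 s, (r : UnitAddCircle) ∈ e.source :=
    hcoe.continuousAt.eventually (e.open_source.mem_nhds hs)
  have hc : ContinuousAt (fun r : ℝ => e (r : UnitAddCircle) - r) s :=
    ((e.continuousAt hs).comp (f := fun r : ℝ => (r : UnitAddCircle)) hcoe.continuousAt).sub
      continuousAt_id
  have hball := hc.eventually (Metric.ball_mem_nhds _ (show (0 : ℝ) < 1 by norm_num))
  have hint : ∀ r : ℝ, (r : UnitAddCircle) ∈ e.source →
      ∃ n : ℤ, (n : ℝ) = e (r : UnitAddCircle) - r := by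
    intro r hr
    have h1 : ((e (r : UnitAddCircle) : ℝ) : UnitAddCircle) = (r : UnitAddCircle) := by
      rw [← UnitAddCircle.symm_of_mem_atlas he, e.left_inv hr]
    have h2 : ((e (r : UnitAddCircle) - r : ℝ) : UnitAddCircle) = 0 := by
      rw [AddCircle.coe_sub, h1, sub_self]
    obtain ⟨n, hn⟩ := (AddCircle.coe_eq_zero_iff (1 : ℝ)).1 h2
    exact ⟨n, by simpa using hn⟩
  filter_upwards [hsrc, hball] with r hr hb
  obtain ⟨n, hn⟩ := hint r hr
  obtain ⟨m, hm⟩ := hint s hs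
  rw [Real.dist_eq, ← hn, ← hm] at hb
  have hnm : n = m := by
    have h3 : |n - m| < 1 := by exact_mod_cast hb
    have := Int.abs_lt_one_iff.1 h3
    omega
  subst hnm
  linarith

instance UnitAddCircle.isManifold : IsManifold 𝓘(ℝ, ℝ) ∞ UnitAddCircle := by
  apply isManifold_of_contDiffOn
  intro e e' he he' s hs
  have hs' : (s : UnitAddCircle) ∈ e'.source := by
    have := hs.1
    simp only [modelWithCornersSelf_coe_symm, preimage_id,
      OpenPartialHomeomorph.trans_source, mem_inter_iff, mem_preimage] at this
    rw [← UnitAddCircle.symm_of_mem_atlas he]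
    exact this.2
  have h := UnitAddCircle.chart_coe_eventually he' hs'
  apply ContDiffAt.contDiffWithinAt
  have h2 : ContDiffAt ℝ ∞ (fun r : ℝ => r + (e' (s : UnitAddCircle) - s)) s := by fun_prop
  refine h2.congr_of_eventuallyEq ?_
  filter_upwards [h] with r hr
  simp only [Function.comp_apply, modelWithCornersSelf_coe, modelWithCornersSelf_coe_symm, id_eq,
    OpenPartialHomeomorph.coe_trans]
  rw [UnitAddCircle.symm_of_mem_atlas he, hr]

/-- The `1`-form `dt` on `S¹ = ℝ / ℤ`. As the charts are local inverses of the projection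
`ℝ → ℝ / ℤ`, the canonical identification of each tangent space with `ℝ` is `dt`. -/
noncomputable def UnitAddCircle.dt (t : UnitAddCircle) : TangentSpace 𝓘(ℝ, ℝ) t →ₗ[ℝ] ℝ :=
  (LinearMap.id : ℝ →ₗ[ℝ] ℝ)

/-- `dt` pulls back to the standard `1`-form on `ℝ`. -/
theorem UnitAddCircle.dt_mfderiv_coe (s v : ℝ) :
    UnitAddCircle.dt (s : UnitAddCircle)
      (mfderiv 𝓘(ℝ, ℝ) 𝓘(ℝ, ℝ) (fun r : ℝ => (r : UnitAddCircle)) s v) = v := by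
  have hcoe : Continuous (fun r : ℝ => (r : UnitAddCircle)) := AddCircle.continuous_mk' 1
  have h := UnitAddCircle.chart_coe_eventually
    (chart_mem_atlas ℝ (s : UnitAddCircle)) (mem_chart_source ℝ (s : UnitAddCircle))
  have hd : HasFDerivAt (fun r : ℝ => r + (chartAt ℝ (s : UnitAddCircle) (s : UnitAddCircle) - s))
      (ContinuousLinearMap.id ℝ ℝ) s := (hasFDerivAt_id s).add_const _
  have hmf : HasMFDerivAt 𝓘(ℝ, ℝ) 𝓘(ℝ, ℝ) (fun r : ℝ => (r : UnitAddCircle)) s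
      (ContinuousLinearMap.id ℝ ℝ) := by
    refine ⟨hcoe.continuousAt, ?_⟩
    apply HasFDerivAt.hasFDerivWithinAt
    refine HasFDerivAt.congr_of_eventuallyEq hd ?_
    filter_upwards [h] with r hr
    simpa [writtenInExtChartAt, chartAt_self_eq] using hr
  rw [hmf.mfderiv]
  rfl

/-! ### Riemannian geometry in local coordinates

`E` is a real vector space with basis `b`, and `G y` is the matrix `(g_ij)` of a metric at the point
with coordinates `y`. A covariant tensor field of rank `k` is given by its components, indexed by
`Fin k → Fin n`. -/

namespace Coord

variable {E : Type*} [NormedAddCommGroup E] [NormedSpace ℝ E] {n k l : ℕ}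

/-- The partial derivative `∂_i u`. -/
noncomputable def pd (b : Module.Basis (Fin n) ℝ E) (i : Fin n) (u : E → ℝ) (y : E) : ℝ :=
  fderiv ℝ u y (b i)

/-- `Γ^m_{ij} = ½ g^{ml} (∂_i g_{jl} + ∂_j g_{il} - ∂_l g_{ij})`, written `christoffel b G m i j`. -/
noncomputable def christoffel (b : Module.Basis (Fin n) ℝ E) (G : E → Matrix (Fin n) (Fin n) ℝ)
    (m i j : Fin n) (y : E) : ℝ :=
  (1 / 2) * ∑ l, (G y)⁻¹ m l *
    (pd b i (fun z => G z j l) y + pd b j (fun z => G z i l) y - pd b l (fun z => G z i j) y)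

/-- The components of `Riem(∂_i, ∂_j) ∂_k = ∑_m riemUp m i j k • ∂_m`, where
`Riem(X, Y) Z = ∇_X ∇_Y Z - ∇_Y ∇_X Z - ∇_{[X, Y]} Z` for the Levi-Civita connection. -/
noncomputable def riemUp (b : Module.Basis (Fin n) ℝ E) (G : E → Matrix (Fin n) (Fin n) ℝ)
    (m i j k : Fin n) (y : E) : ℝ :=
  pd b i (christoffel b G m j k) y - pd b j (christoffel b G m i k) y +
    ∑ s, (christoffel b G m i s y * christoffel b G s j k y -
      christoffel b G m j s y * christoffel b G s i k y)

/-- `riem(∂_i, ∂_j, ∂_k, ∂_l) = ⟨Riem(∂_i, ∂_j) ∂_k, ∂_l⟩`. -/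
noncomputable def riem (b : Module.Basis (Fin n) ℝ E) (G : E → Matrix (Fin n) (Fin n) ℝ)
    (i j k l : Fin n) (y : E) : ℝ :=
  ∑ m, riemUp b G m i j k y * G y m l

/-- `ric(X, Y) = tr (V ↦ Riem(V, X) Y)`. -/
noncomputable def ric (b : Module.Basis (Fin n) ℝ E) (G : E → Matrix (Fin n) (Fin n) ℝ)
    (i j : Fin n) (y : E) : ℝ :=
  ∑ m, riemUp b G m m i j y

/-- Scalar curvature. -/
noncomputable def scal (b : Module.Basis (Fin n) ℝ E) (G : E → Matrix (Fin n) (Fin n) ℝ)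
    (y : E) : ℝ :=
  ∑ i, ∑ j, (G y)⁻¹ i j * ric b G i j y

/-- Einstein tensor `ric - ½ R g`. -/
noncomputable def einstein (b : Module.Basis (Fin n) ℝ E) (G : E → Matrix (Fin n) (Fin n) ℝ)
    (i j : Fin n) (y : E) : ℝ :=
  ric b G i j y - (1 / 2) * scal b G y * G y i j

/-- Weyl tensor (totally trace-free part of `riem`) in dimension `n ≥ 3`. -/
noncomputable def weyl (b : Module.Basis (Fin n) ℝ E) (G : E → Matrix (Fin n) (Fin n) ℝ)
    (I : Fin 4 → Fin n) (y : E) : ℝ :=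
  riem b G (I 0) (I 1) (I 2) (I 3) y
    - 1 / ((n : ℝ) - 2) *
      (ric b G (I 1) (I 2) y * G y (I 0) (I 3) + ric b G (I 0) (I 3) y * G y (I 1) (I 2)
        - ric b G (I 0) (I 2) y * G y (I 1) (I 3) - ric b G (I 1) (I 3) y * G y (I 0) (I 2))
    + scal b G y / (((n : ℝ) - 1) * ((n : ℝ) - 2)) *
      (G y (I 1) (I 2) * G y (I 0) (I 3) - G y (I 0) (I 2) * G y (I 1) (I 3))

/-- Levi-Civita covariant derivative of a covariant tensor field, the new index coming first:
`(∇S)_{m i₁ … i_k} = ∂_m S_{i₁ … i_k} - ∑_a Γ^s_{m i_a} S_{i₁ … s … i_k}`. -/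
noncomputable def covD (b : Module.Basis (Fin n) ℝ E) (G : E → Matrix (Fin n) (Fin n) ℝ)
    (S : (Fin k → Fin n) → E → ℝ) (J : Fin (k + 1) → Fin n) (y : E) : ℝ :=
  pd b (J 0) (S (Fin.tail J)) y -
    ∑ a : Fin k, ∑ s, christoffel b G s (J 0) (Fin.tail J a) y *
      S (Function.update (Fin.tail J) a s) y

/-- Bach tensor `B_{ij} = -4 (∇^p ∇^q C_{p i j q} + ½ ric^{pq} C_{p i j q})`, where `C` is the Weyl
tensor. The factor makes it the `L²`-gradient of `g ↦ ∫ ‖C‖² dvol` in dimension four, with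
`‖C‖²` the full contraction `C_{ijkl} C^{ijkl}`. -/
noncomputable def bach (b : Module.Basis (Fin n) ℝ E) (G : E → Matrix (Fin n) (Fin n) ℝ)
    (i j : Fin n) (y : E) : ℝ :=
  -4 * ∑ p, ∑ q, ∑ r, ∑ s, (G y)⁻¹ p r * (G y)⁻¹ q s *
    (covD b G (covD b G (weyl b G)) ![r, s, p, i, j, q] y
      + (1 / 2) * ric b G r s y * weyl b G ![p, i, j, q] y)

/-- Exterior derivative of a `k`-form,
`(dσ)_{i₀ … i_k} = ∑_a (-1)^a ∂_{i_a} σ_{i₀ … î_a … i_k}`. -/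
noncomputable def extD (b : Module.Basis (Fin n) ℝ E) (σ : (Fin k → Fin n) → E → ℝ)
    (J : Fin (k + 1) → Fin n) (y : E) : ℝ :=
  ∑ a : Fin (k + 1), (-1 : ℝ) ^ (a : ℕ) * pd b (J a) (σ (a.removeNth J)) y

/-- The Levi-Civita symbol `ε_{i₁ … i_n}`. -/
noncomputable def leviCivita (I : Fin n → Fin n) : ℝ :=
  Matrix.det (Matrix.of fun a c : Fin n => if I a = c then (1 : ℝ) else 0)

/-- Hodge star of a `k`-form (`k + l = n`) with respect to the coordinate orientation,
`(*σ)_J = (1 / k!) √(det g) ∑ g^{i₁ m₁} ⋯ g^{i_k m_k} σ_{m₁ … m_k} ε_{i₁ … i_k J}`, so that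
`η ∧ *σ = ⟨η, σ⟩_g dvol_g`. -/
noncomputable def hodge (h : n = k + l) (G : E → Matrix (Fin n) (Fin n) ℝ)
    (σ : (Fin k → Fin n) → E → ℝ) (J : Fin l → Fin n) (y : E) : ℝ :=
  1 / (k.factorial : ℝ) * √(G y).det *
    ∑ I : Fin k → Fin n, ∑ M : Fin k → Fin n,
      (∏ a, (G y)⁻¹ (I a) (M a)) * σ M y * leviCivita (Fin.append I J ∘ Fin.cast h)

/-- Codifferential `δ = - * d *` of a `3`-form in dimension four
(it does not depend on the orientation). -/
noncomputable def codiff (b : Module.Basis (Fin 4) ℝ E) (G : E → Matrix (Fin 4) (Fin 4) ℝ)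
    (T : (Fin 3 → Fin 4) → E → ℝ) (J : Fin 2 → Fin 4) (y : E) : ℝ :=
  -(hodge (k := 2) (l := 2) rfl G (extD b (hodge (k := 3) (l := 1) rfl G T)) J y)

/-- The squared norm `‖S‖²` of a covariant tensor (no factor `1 / k!`). -/
noncomputable def normSq (G : E → Matrix (Fin n) (Fin n) ℝ)
    (S : (Fin k → Fin n) → E → ℝ) (y : E) : ℝ :=
  ∑ I : Fin k → Fin n, ∑ M : Fin k → Fin n, (∏ a, (G y)⁻¹ (I a) (M a)) * S I y * S M y

/-- The symmetric tensor `g^η(X, Y) = ⟨X ⌟ η, Y ⌟ η⟩_g` of a `(k+1)`-form `η`, where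
`⟨·, ·⟩_g` is the scalar product of `k`-forms (with factor `1 / k!`); `g^η = η ⊗ η` for `1`-forms. -/
noncomputable def gForm (G : E → Matrix (Fin n) (Fin n) ℝ)
    (η : (Fin (k + 1) → Fin n) → E → ℝ) (i j : Fin n) (y : E) : ℝ :=
  1 / (k.factorial : ℝ) * ∑ I : Fin k → Fin n, ∑ M : Fin k → Fin n,
    (∏ a, (G y)⁻¹ (I a) (M a)) * η (Fin.cons i I : Fin (k + 1) → Fin n) y *
      η (Fin.cons j M : Fin (k + 1) → Fin n) y

/-- Left hand side of the first equation of motion: `3 γ₁ T - γ₂ d δ T`. -/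
noncomputable def torsionEq (γ₁ γ₂ : ℝ) (b : Module.Basis (Fin 4) ℝ E)
    (G : E → Matrix (Fin 4) (Fin 4) ℝ) (T : (Fin 3 → Fin 4) → E → ℝ)
    (J : Fin 3 → Fin 4) (y : E) : ℝ :=
  3 * γ₁ * T J y - γ₂ * extD b (codiff b G T) J y

/-- Left hand side of the second equation of motion:
`α G^g - β B^g + γ₁ (-6 g^{*T} + ½ ‖T‖² g) - γ₂ (-2 g^{d*T} + ½ ‖δT‖² g)`. -/
noncomputable def metricEq (α β γ₁ γ₂ : ℝ) (b : Module.Basis (Fin 4) ℝ E)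
    (G : E → Matrix (Fin 4) (Fin 4) ℝ) (T : (Fin 3 → Fin 4) → E → ℝ)
    (i j : Fin 4) (y : E) : ℝ :=
  α * einstein b G i j y - β * bach b G i j y
    + γ₁ * (-6 * gForm G (hodge (k := 3) (l := 1) rfl G T) i j y
        + (1 / 2) * normSq G T y * G y i j)
    - γ₂ * (-2 * gForm G (extD b (hodge (k := 3) (l := 1) rfl G T)) i j y
        + (1 / 2) * normSq G (codiff b G T) y * G y i j)

end Coord

/-! ### Tensor fields on manifolds and their components in local coordinates -/

section Manifold

variable {E : Type*} [NormedAddCommGroup E] [NormedSpace ℝ E]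
  {H : Type*} [TopologicalSpace H] (I : ModelWithCorners ℝ E H)
  {M : Type*} [TopologicalSpace M] [ChartedSpace H M] {n k : ℕ}

/-- The coordinate vector `∂_i` of the chart `e` (with linear coordinates given by the basis `b`)
at the point with coordinates `y`. -/
noncomputable def coordVec (e : OpenPartialHomeomorph M H) (b : Module.Basis (Fin n) ℝ E)
    (i : Fin n) (y : E) : TangentSpace I ((e.extend I).symm y) :=
  mfderiv 𝓘(ℝ, E) I (e.extend I).symm y (b i)

/-- The components `g_ij` of a field of bilinear forms. -/
noncomputable def coordMetric
    (g : ∀ x : M, TangentSpace I x →ₗ[ℝ] TangentSpace I x →ₗ[ℝ] ℝ)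
    (e : OpenPartialHomeomorph M H) (b : Module.Basis (Fin n) ℝ E) (y : E) :
    Matrix (Fin n) (Fin n) ℝ :=
  Matrix.of fun i j => g ((e.extend I).symm y) (coordVec I e b i y) (coordVec I e b j y)

/-- The components of a `k`-form. -/
noncomputable def coordForm (T : ∀ x : M, TangentSpace I x [⋀^Fin k]→ₗ[ℝ] ℝ)
    (e : OpenPartialHomeomorph M H) (b : Module.Basis (Fin n) ℝ E)
    (J : Fin k → Fin n) (y : E) : ℝ :=
  T ((e.extend I).symm y) fun a => coordVec I e b (J a) y

/-- The triple `(M, g, T)`, with `M` a smooth `4`-manifold without boundary, solves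
`3 γ₁ T - γ₂ d δ T = 0` and
`α G^g - β B^g + γ₁ (-6 g^{*T} + ½ ‖T‖² g) - γ₂ (-2 g^{d*T} + ½ ‖δT‖² g) = 0`
(in all local coordinates of the smooth structure). -/
def SolvesEquationsOfMotion (α β γ₁ γ₂ : ℝ)
    (g : ∀ x : M, TangentSpace I x →ₗ[ℝ] TangentSpace I x →ₗ[ℝ] ℝ)
    (T : ∀ x : M, TangentSpace I x [⋀^Fin 3]→ₗ[ℝ] ℝ) : Prop :=
  ∀ e ∈ IsManifold.maximalAtlas I ∞ M, ∀ b : Module.Basis (Fin 4) ℝ E,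
    ∀ y ∈ (e.extend I).target,
      (∀ J, Coord.torsionEq γ₁ γ₂ b (coordMetric I g e b) (coordForm I T e b) J y = 0) ∧
      (∀ i j, Coord.metricEq α β γ₁ γ₂ b (coordMetric I g e b) (coordForm I T e b) i j y = 0)

/-- The metric `g` on the `n`-manifold `M` has constant sectional curvature: for some real `κ`,
`⟨Riem(X, Y) Y, X⟩ = κ (|X|² |Y|² - ⟨X, Y⟩²)` for all tangent vectors `X`, `Y`
(with components `X`, `Y` in local coordinates). -/
def HasConstantCurvature (n : ℕ)
    (g : ∀ x : M, TangentSpace I x →ₗ[ℝ] TangentSpace I x →ₗ[ℝ] ℝ) : Prop :=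
  ∃ κ : ℝ, ∀ e ∈ IsManifold.maximalAtlas I ∞ M, ∀ b : Module.Basis (Fin n) ℝ E,
    ∀ y ∈ (e.extend I).target, ∀ X Y : Fin n → ℝ,
      ∑ i, ∑ j, ∑ k, ∑ l, Coord.riem b (coordMetric I g e b) i j k l y * X i * Y j * Y k * X l =
        κ * ((X ⬝ᵥ (coordMetric I g e b y).mulVec X) * (Y ⬝ᵥ (coordMetric I g e b y).mulVec Y)
          - (X ⬝ᵥ (coordMetric I g e b y).mulVec Y) ^ 2)

/-- The Riemannian metric of a manifold, as a field of bilinear forms. -/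
noncomputable def riemannianMetric [RiemannianBundle (fun x : M => TangentSpace I x)] (x : M) :
    TangentSpace I x →ₗ[ℝ] TangentSpace I x →ₗ[ℝ] ℝ :=
  innerₗ (TangentSpace I x)

end Manifold

/-! ### Oriented Riemannian `3`-manifolds and warped products over the circle -/

section Warped

variable {N : Type*} [TopologicalSpace N] [ChartedSpace (EuclideanSpace ℝ (Fin 3)) N]
  [RiemannianBundle (fun x : N => TangentSpace (𝓡 3) x)]

instance tangentSpace_finrank_three (x : N) :
    Fact (Module.finrank ℝ (TangentSpace (𝓡 3) x) = 3) :=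
  ⟨(finrank_euclideanSpace_fin : Module.finrank ℝ (EuclideanSpace ℝ (Fin 3)) = 3)⟩

/-- The Riemannian volume form of a Riemannian `3`-manifold with oriented tangent spaces. -/
noncomputable def dvol (o : ∀ x : N, Orientation ℝ (TangentSpace (𝓡 3) x) (Fin 3)) (x : N) :
    TangentSpace (𝓡 3) x [⋀^Fin 3]→ₗ[ℝ] ℝ :=
  (o x).volumeForm

/-- A family of orientations of the tangent spaces is an orientation of the manifold if near every
point there is a chart whose coordinate frames are all positively oriented. -/
def IsManifoldOrientation (o : ∀ x : N, Orientation ℝ (TangentSpace (𝓡 3) x) (Fin 3)) : Prop :=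
  ∀ x : N, ∃ e ∈ IsManifold.maximalAtlas (𝓡 3) ∞ N, x ∈ e.source ∧
    ∃ b : Module.Basis (Fin 3) ℝ (EuclideanSpace ℝ (Fin 3)), ∀ y ∈ (e.extend (𝓡 3)).target,
      0 < dvol o ((e.extend (𝓡 3)).symm y) fun i => coordVec (𝓡 3) e b i y

/-- The warped product metric `dt² ⊕ f(t)² h` on `S¹ × N`. -/
noncomputable def warpedMetric (f : UnitAddCircle → ℝ) (x : UnitAddCircle × N) :
    TangentSpace (𝓘(ℝ, ℝ).prod (𝓡 3)) x →ₗ[ℝ] TangentSpace (𝓘(ℝ, ℝ).prod (𝓡 3)) x →ₗ[ℝ] ℝ :=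
  let p := (mfderiv (𝓘(ℝ, ℝ).prod (𝓡 3)) 𝓘(ℝ, ℝ) Prod.fst x).toLinearMap
  let q := (mfderiv (𝓘(ℝ, ℝ).prod (𝓡 3)) (𝓡 3) Prod.snd x).toLinearMap
  (LinearMap.mul ℝ ℝ).compl₁₂ (UnitAddCircle.dt x.1 ∘ₗ p) (UnitAddCircle.dt x.1 ∘ₗ p)
    + f x.1 ^ 2 • (riemannianMetric (𝓡 3) x.2).compl₁₂ q q

/-- The `3`-form `τ · π^* dvol_N` on `S¹ × N`, with `π : S¹ × N → N` the projection. -/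
noncomputable def warpedTorsion (o : ∀ x : N, Orientation ℝ (TangentSpace (𝓡 3) x) (Fin 3))
    (τ : UnitAddCircle × N → ℝ) (x : UnitAddCircle × N) :
    TangentSpace (𝓘(ℝ, ℝ).prod (𝓡 3)) x [⋀^Fin 3]→ₗ[ℝ] ℝ :=
  τ x • (dvol o x.2).compLinearMap
    (mfderiv (𝓘(ℝ, ℝ).prod (𝓡 3)) (𝓡 3) Prod.snd x).toLinearMap

end Warped

namespace Coord

variable {E : Type*} [NormedAddCommGroup E] [NormedSpace ℝ E] {n k l : ℕ}

/-! ### Partial derivatives -/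

/-! The conformal identity `dt² + f² h = f² ((dt/f)² + h)` shows that `g` is locally conformal to
the product of a line with a space of constant curvature. Such a product is conformally flat, so the
Weyl tensor and with it the Bach tensor vanish. What remains is an algebraic argument on the fiber
directions of the second equation.

Since `T` is a multiple of the fiber volume form, `*T` is a multiple of `dt`. Hence `ω = d*T` has no
component along two fiber directions, and for `X`, `Y` tangent to the fiber `g^{*T}(X, Y) = 0` and
`g^ω(X, Y) = a(X) a(Y)` with `a(X) = ω(X, ∂_t)`. The Einstein tensor restricted to the fiber is a
multiple of `h`, by constant curvature. The fiber block of the second equation therefore reads `c h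
+ 2 γ₂ a ⊗ a = 0`. Evaluation on a nonzero vector in the kernel of `a`, which exists because the
fiber has dimension at least two, gives `c = 0`, hence `a = 0`. So `d*T = 0`, thus `δT = 0`, and the
first equation reduces to `3 γ₁ T = 0`.

All of this is local and is carried out in product charts. `IsMetricOn.riem_of_sectional` turns
constant sectional curvature into the full curvature tensor. `IsWarpedOn.weyl_eq_zero` gets
conformal flatness by direct computation of the curvature rather than by the conformal change.
`eq_zero_of_posDef_add_dyad` is the rank argument, and `IsWarpedOn.torsion_eq_zero` combines them.
-/

theorem pd_congr_of_eqOn (b : Module.Basis (Fin n) ℝ E) (i : Fin n) {u v : E → ℝ} {U : Set E}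
    (hU : IsOpen U) (h : EqOn u v U) {y : E} (hy : y ∈ U) : pd b i u y = pd b i v y := by
  rw [pd, pd, Filter.EventuallyEq.fderiv_eq (h.eventuallyEq_of_mem (hU.mem_nhds hy))]

theorem pd_const (b : Module.Basis (Fin n) ℝ E) (i : Fin n) (c : ℝ) (y : E) :
    pd b i (fun _ => c) y = 0 := by
  simp [pd]

theorem pd_eq_zero_of_eqOn (b : Module.Basis (Fin n) ℝ E) (i : Fin n) {u : E → ℝ} {U : Set E}
    (hU : IsOpen U) (h : ∀ y ∈ U, u y = 0) {y : E} (hy : y ∈ U) : pd b i u y = 0 := by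
  rw [pd_congr_of_eqOn b i hU (v := fun _ => 0) h hy, pd_const]

theorem pd_mul (b : Module.Basis (Fin n) ℝ E) (i : Fin n) {u v : E → ℝ} {y : E}
    (hu : DifferentiableAt ℝ u y) (hv : DifferentiableAt ℝ v y) :
    pd b i (fun z => u z * v z) y = pd b i u y * v y + u y * pd b i v y := by
  simp only [pd]
  rw [fderiv_fun_mul hu hv]
  simp
  ring

theorem pd_sum {ι : Type*} (s : Finset ι) (b : Module.Basis (Fin n) ℝ E) (i : Fin n)
    {u : ι → E → ℝ} {y : E} (hu : ∀ j ∈ s, DifferentiableAt ℝ (u j) y) :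
    pd b i (fun z => ∑ j ∈ s, u j z) y = ∑ j ∈ s, pd b i (u j) y := by
  simp only [pd]
  rw [fderiv_fun_sum hu]
  simp

theorem pd_add (b : Module.Basis (Fin n) ℝ E) (i : Fin n) {u v : E → ℝ} {y : E}
    (hu : DifferentiableAt ℝ u y) (hv : DifferentiableAt ℝ v y) :
    pd b i (fun z => u z + v z) y = pd b i u y + pd b i v y := by
  simp only [pd]
  rw [fderiv_fun_add hu hv]
  simp

theorem contDiffOn_pd (b : Module.Basis (Fin n) ℝ E) (i : Fin n) {u : E → ℝ} {U : Set E}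
    (hU : IsOpen U) (hu : ContDiffOn ℝ ∞ u U) : ContDiffOn ℝ ∞ (pd b i u) U :=
  (hu.fderiv_of_isOpen hU (by simp)).clm_apply contDiffOn_const

/-- Schwarz's theorem. Among the curvature symmetries only antisymmetry in the last two indices
depends on it. -/
theorem pd_comm (b : Module.Basis (Fin n) ℝ E) (i j : Fin n) {u : E → ℝ} {U : Set E}
    (hU : IsOpen U) (hu : ContDiffOn ℝ ∞ u U) {y : E} (hy : y ∈ U) :
    pd b i (pd b j u) y = pd b j (pd b i u) y := by
  have hat : ContDiffAt ℝ ∞ u y := hu.contDiffAt (hU.mem_nhds hy)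
  have hd : DifferentiableAt ℝ (fderiv ℝ u) y :=
    (hat.fderiv_right (m := 1) (by norm_cast)).differentiableAt (by simp)
  have hs : IsSymmSndFDerivAt ℝ u y := hat.isSymmSndFDerivAt (by simpa using WithTop.coe_le_coe.2 (le_top (a := (2 : ℕ∞))))
  have key : ∀ p q : Fin n, pd b p (pd b q u) y = fderiv ℝ (fderiv ℝ u) y (b p) (b q) := by
    intro p q
    have : pd b q u = fun z => fderiv ℝ u z (b q) := rfl
    rw [this, pd, fderiv_clm_apply hd (differentiableAt_const _)]
    simp
  rw [key, key, hs.eq]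

/-! ### Metrics in coordinates -/

/-- `G` is a smooth nondegenerate symmetric matrix field on the open set `U`. -/
structure IsMetricOn (G : E → Matrix (Fin n) (Fin n) ℝ) (U : Set E) : Prop where
  isOpen : IsOpen U
  smooth : ∀ i j, ContDiffOn ℝ ∞ (fun z => G z i j) U
  symm : ∀ z ∈ U, ∀ i j, G z i j = G z j i
  det_ne_zero : ∀ z ∈ U, (G z).det ≠ 0

/-- Christoffel symbols of the first kind `Γ_{l,ij} = ½ (∂_i g_{jl} + ∂_j g_{il} - ∂_l g_{ij})`. -/
noncomputable def lowerChristoffel (b : Module.Basis (Fin n) ℝ E)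
    (G : E → Matrix (Fin n) (Fin n) ℝ) (l i j : Fin n) (y : E) : ℝ :=
  (1 / 2) * (pd b i (fun z => G z j l) y + pd b j (fun z => G z i l) y
    - pd b l (fun z => G z i j) y)

theorem christoffel_eq_sum_inv_mul (b : Module.Basis (Fin n) ℝ E)
    (G : E → Matrix (Fin n) (Fin n) ℝ) (m i j : Fin n) (y : E) :
    christoffel b G m i j y = ∑ l, (G y)⁻¹ m l * lowerChristoffel b G l i j y := by
  simp only [christoffel, lowerChristoffel, Finset.mul_sum]
  exact Finset.sum_congr rfl fun l _ => by ring

theorem contDiffOn_det {ι : Type*} [Fintype ι] [DecidableEq ι] {A : E → Matrix ι ι ℝ} {U : Set E}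
    (h : ∀ i j, ContDiffOn ℝ ∞ (fun z => A z i j) U) :
    ContDiffOn ℝ ∞ (fun z => (A z).det) U := by
  simp only [Matrix.det_apply']
  exact ContDiffOn.sum fun σ _ => contDiffOn_const.mul (contDiffOn_prod fun i _ => h _ _)

namespace IsMetricOn

variable {G : E → Matrix (Fin n) (Fin n) ℝ} {U : Set E} (hG : IsMetricOn G U)
  (b : Module.Basis (Fin n) ℝ E) {y : E} (hy : y ∈ U)

include hG

/-- Cramer's rule: an entry of the adjugate is the determinant of the matrix with one row replaced
by a constant vector, so it is as smooth as the entries. -/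
theorem contDiffOn_inv (i j : Fin n) : ContDiffOn ℝ ∞ (fun z => (G z)⁻¹ i j) U := by
  simp only [Matrix.inv_def, Ring.inverse_eq_inv', Matrix.smul_apply, smul_eq_mul,
    Matrix.adjugate_apply]
  refine ((contDiffOn_det hG.smooth).inv hG.det_ne_zero).mul (contDiffOn_det fun p q => ?_)
  by_cases hp : p = j
  · subst hp
    simpa using contDiffOn_const
  · simpa [Matrix.updateRow_ne hp] using hG.smooth p q

theorem contDiffOn_lowerChristoffel (l i j : Fin n) :
    ContDiffOn ℝ ∞ (lowerChristoffel b G l i j) U :=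
  contDiffOn_const.mul (((contDiffOn_pd b _ hG.isOpen (hG.smooth _ _)).add
    (contDiffOn_pd b _ hG.isOpen (hG.smooth _ _))).sub
    (contDiffOn_pd b _ hG.isOpen (hG.smooth _ _)))

theorem contDiffOn_christoffel (m i j : Fin n) : ContDiffOn ℝ ∞ (christoffel b G m i j) U := by
  have : christoffel b G m i j = fun y => ∑ l, (G y)⁻¹ m l * lowerChristoffel b G l i j y :=
    funext fun y => christoffel_eq_sum_inv_mul b G m i j y
  rw [this]
  exact ContDiffOn.sum fun l _ =>
    (hG.contDiffOn_inv m l).mul (hG.contDiffOn_lowerChristoffel b l i j)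

include hy

theorem pd_symm (l i j : Fin n) : pd b l (fun z => G z i j) y = pd b l (fun z => G z j i) y :=
  pd_congr_of_eqOn b l hG.isOpen (fun z hz => hG.symm z hz i j) hy

theorem lowerChristoffel_symm (l i j : Fin n) :
    lowerChristoffel b G l i j y = lowerChristoffel b G l j i y := by
  simp only [lowerChristoffel, hG.pd_symm b hy l i j]
  ring

theorem christoffel_symm (m i j : Fin n) : christoffel b G m i j y = christoffel b G m j i y := by
  simp only [christoffel_eq_sum_inv_mul, hG.lowerChristoffel_symm b hy _ i j]

/-- Compatibility of the Levi-Civita connection with the metric, `∇g = 0`. -/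
theorem pd_eq_lowerChristoffel_add (i l m : Fin n) :
    pd b i (fun z => G z l m) y = lowerChristoffel b G m i l y + lowerChristoffel b G l i m y := by
  simp only [lowerChristoffel, hG.pd_symm b hy i m l]
  ring

omit b in
theorem mul_inv_apply (i j : Fin n) :
    ∑ m, G y i m * (G y)⁻¹ m j = if i = j then 1 else 0 := by
  rw [← Matrix.mul_apply, Matrix.mul_nonsing_inv _ (isUnit_iff_ne_zero.2 (hG.det_ne_zero y hy)),
    Matrix.one_apply]

omit b in
theorem inv_mul_apply (i j : Fin n) :
    ∑ m, (G y)⁻¹ i m * G y m j = if i = j then 1 else 0 := by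
  rw [← Matrix.mul_apply, Matrix.nonsing_inv_mul _ (isUnit_iff_ne_zero.2 (hG.det_ne_zero y hy)),
    Matrix.one_apply]

theorem sum_mul_christoffel (l i j : Fin n) :
    ∑ m, G y l m * christoffel b G m i j y = lowerChristoffel b G l i j y := by
  simp only [christoffel_eq_sum_inv_mul, Finset.mul_sum]
  rw [Finset.sum_comm]
  simp only [← mul_assoc, ← Finset.sum_mul, hG.mul_inv_apply hy]
  simp

/-- `∂_i Γ_{l,jk}` in terms of Christoffel symbols of the second kind. -/
theorem pd_lowerChristoffel (i l j k : Fin n) :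
    pd b i (lowerChristoffel b G l j k) y =
      ∑ m, (pd b i (fun z => G z l m) y * christoffel b G m j k y
        + G y l m * pd b i (christoffel b G m j k) y) := by
  have hn := hG.isOpen.mem_nhds hy
  have hd1 : ∀ m, DifferentiableAt ℝ (fun z => G z l m) y := fun m =>
    ((hG.smooth l m).contDiffAt hn).differentiableAt (by simp)
  have hd2 : ∀ m, DifferentiableAt ℝ (christoffel b G m j k) y := fun m =>
    ((hG.contDiffOn_christoffel b m j k).contDiffAt hn).differentiableAt (by simp)
  rw [pd_congr_of_eqOn b i hG.isOpen
    (fun z hz => (hG.sum_mul_christoffel b hz l j k).symm) hy,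
    pd_sum _ _ _ fun m _ => (hd1 m).fun_mul (hd2 m)]
  exact Finset.sum_congr rfl fun m _ => pd_mul b i (hd1 m) (hd2 m)

/-- The curvature tensor in terms of Christoffel symbols of the first kind. -/
theorem riem_eq (i j k l : Fin n) :
    riem b G i j k l y = pd b i (lowerChristoffel b G l j k) y
      - pd b j (lowerChristoffel b G l i k) y
      - ∑ m, (lowerChristoffel b G m i l y * christoffel b G m j k y
        - lowerChristoffel b G m j l y * christoffel b G m i k y) := by
  have hs : ∀ i j k : Fin n,
      ∑ m, (∑ s, christoffel b G m i s y * christoffel b G s j k y) * G y m l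
        = ∑ s, lowerChristoffel b G l i s y * christoffel b G s j k y := by
    intro i j k
    simp only [Finset.sum_mul]
    rw [Finset.sum_comm]
    refine Finset.sum_congr rfl fun s _ => ?_
    rw [← hG.sum_mul_christoffel b hy l i s, Finset.sum_mul]
    refine Finset.sum_congr rfl fun m _ => ?_
    rw [hG.symm y hy l m]
    ring
  simp only [riem, riemUp, add_mul, sub_mul, Finset.sum_add_distrib, Finset.sum_sub_distrib, hs]
  -- Lowering the index of `∂_i Γ^m_{jk}` produces `∂_i Γ_{l,jk}` minus `(∂_i g_{lm}) Γ^m_{jk}`.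
  -- Metric compatibility splits the latter in two: one half cancels the quadratic terms of
  -- `riemUp`, the other gives the quadratic terms of the claim, with their reversed sign.
  rw [hG.pd_lowerChristoffel b hy i l j k, hG.pd_lowerChristoffel b hy j l i k]
  simp only [hG.pd_eq_lowerChristoffel_add b hy, add_mul, Finset.sum_add_distrib]
  have hc : ∀ m, ∀ i j k, pd b i (christoffel b G m j k) y * G y m l
      = G y l m * pd b i (christoffel b G m j k) y := by
    intro m i j k
    rw [hG.symm y hy m l, mul_comm]
  simp only [hc]
  ring

/-- Symmetrizing in `k, l` turns the derivative terms into the commutator of `∂_i` and `∂_j` on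
`g_{kl}`. The quadratic terms are scalar products of Christoffel vectors, and they cancel because
the metric is symmetric. -/
theorem riem_antisymm_right (i j k l : Fin n) : riem b G i j k l y = -riem b G i j l k y := by
  have hA : ∀ i j k l : Fin n, ∑ m, lowerChristoffel b G m i l y * christoffel b G m j k y
      = ∑ m, lowerChristoffel b G m j k y * christoffel b G m i l y := by
    intro i j k l
    simp only [← hG.sum_mul_christoffel b hy, Finset.sum_mul]
    rw [Finset.sum_comm]
    refine Finset.sum_congr rfl fun p _ => Finset.sum_congr rfl fun q _ => ?_
    rw [hG.symm y hy q p]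
    ring
  have hp : ∀ i j k l : Fin n, pd b i (lowerChristoffel b G l j k) y
      + pd b i (lowerChristoffel b G k j l) y = pd b i (pd b j (fun z => G z k l)) y := by
    intro i j k l
    have hn := hG.isOpen.mem_nhds hy
    rw [← pd_add b i
      (((hG.contDiffOn_lowerChristoffel b l j k).contDiffAt hn).differentiableAt (by simp))
      (((hG.contDiffOn_lowerChristoffel b k j l).contDiffAt hn).differentiableAt (by simp))]
    exact pd_congr_of_eqOn b i hG.isOpen
      (fun z hz => (hG.pd_eq_lowerChristoffel_add b hz j k l).symm) hy
  rw [hG.riem_eq b hy, hG.riem_eq b hy]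
  simp only [Finset.sum_sub_distrib]
  have h1 := hp i j k l
  have h2 := hp j i k l
  have h3 := pd_comm b i j hG.isOpen (hG.smooth k l) hy
  have h4 := hA i j k l
  have h5 := hA j i k l
  linarith

omit hG hy in
theorem _root_.Coord.riem_antisymm_left (G : E → Matrix (Fin n) (Fin n) ℝ) (i j k l : Fin n) (y : E) :
    riem b G i j k l y = -riem b G j i k l y := by
  simp only [riem, riemUp, ← Finset.sum_neg_distrib, Finset.sum_sub_distrib]
  exact Finset.sum_congr rfl fun m _ => by ring

/-- This is vanishing torsion: once the lower indices of `Γ` commute, the terms of the cyclic sum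
cancel in pairs. -/
theorem riem_bianchi (i j k l : Fin n) :
    riem b G i j k l y + riem b G j k i l y + riem b G k i j l y = 0 := by
  have h : ∀ p q r m, pd b p (christoffel b G m q r) y = pd b p (christoffel b G m r q) y :=
    fun p q r m => pd_congr_of_eqOn b p hG.isOpen
      (fun z hz => hG.christoffel_symm b hz m q r) hy
  simp only [riem, riemUp, ← Finset.sum_add_distrib]
  refine Finset.sum_eq_zero fun m _ => ?_
  simp only [Finset.sum_sub_distrib]
  rw [h i j k, h j k i, h k i j]
  simp only [hG.christoffel_symm b hy _ j k, hG.christoffel_symm b hy _ k i,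
    hG.christoffel_symm b hy _ i j]
  ring

end IsMetricOn

/-- An algebraic curvature tensor with vanishing symmetrized sectional curvatures vanishes. -/
theorem curvature_eq_zero {S : Fin n → Fin n → Fin n → Fin n → ℝ}
    (h1 : ∀ i j k l, S i j k l = -S j i k l) (h2 : ∀ i j k l, S i j k l = -S i j l k)
    (h3 : ∀ i j k l, S i j k l + S j k i l + S k i j l = 0)
    (h4 : ∀ i j k l, S i j k l + S i k j l + S l j k i + S l k j i = 0) (i j k l : Fin n) :
    S i j k l = 0 := by
  -- The usual derivation of pair symmetry: add Bianchi identities over the four cyclic rotations of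
  -- the indices and use the two antisymmetries.
  have hpair : ∀ i j k l, S i j k l = S k l i j := by
    intro i j k l
    linarith [h3 i j k l, h3 j k l i, h3 k l i j, h3 l i j k, h1 i j k l, h2 i j k l, h1 j k i l,
      h2 j k i l, h1 k i j l, h2 k i j l, h1 k l i j, h2 k l i j, h1 l i j k, h2 l i j k,
      h1 j l i k, h2 j l i k, h1 j k l i, h1 k l j i, h1 l j k i, h2 l j k i, h1 i k l j,
      h2 i k l j, h1 l i k j, h2 k l j i, h1 i j l k, h1 j l k i, h1 i l j k, h2 i l j k,
      h2 k i l j]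
  -- Pair symmetry identifies the last two terms of `h4` with the first two, so `S` is antisymmetric
  -- in its middle indices as well. The three terms of the Bianchi identity are then equal, and `3 S
  -- = 0`.
  have hanti : ∀ i j k l, S i j k l = -S i k j l := by
    intro i j k l
    linarith [h4 i j k l, hpair l j k i, hpair l k j i, h1 k i l j, h2 i k l j, h1 j i l k,
      h2 i j l k]
  linarith [h3 i j k l, hanti i j k l, h1 i k j l, h1 j i k l, hanti j i k l, h1 k i j l]

/-- In coordinates, a metric of constant sectional curvature `κ` has curvature tensor
`κ (g_{jk} g_{il} - g_{ik} g_{jl})`. -/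
theorem IsMetricOn.riem_of_sectional {G : E → Matrix (Fin n) (Fin n) ℝ} {U : Set E}
    (hG : IsMetricOn G U) (b : Module.Basis (Fin n) ℝ E) {y : E} (hy : y ∈ U) {κ : ℝ}
    (h : ∀ X Y : Fin n → ℝ,
      ∑ i, ∑ j, ∑ k, ∑ l, riem b G i j k l y * X i * Y j * Y k * X l =
        κ * ((X ⬝ᵥ (G y).mulVec X) * (Y ⬝ᵥ (G y).mulVec Y) - (X ⬝ᵥ (G y).mulVec Y) ^ 2))
    (i j k l : Fin n) :
    riem b G i j k l y = κ * (G y j k * G y i l - G y i k * G y j l) := by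
  have hs := hG.symm y hy
  rw [← sub_eq_zero]
  refine curvature_eq_zero
    (S := fun i j k l => riem b G i j k l y - κ * (G y j k * G y i l - G y i k * G y j l))
    ?_ ?_ ?_ ?_ i j k l
  · intro i j k l
    linear_combination riem_antisymm_left b G i j k l y
  · intro i j k l
    linear_combination hG.riem_antisymm_right b hy i j k l
  · intro i j k l
    rw [hs k j, hs i k, hs j i]
    linear_combination hG.riem_bianchi b hy i j k l
  · intro i j k l
    -- Polarization of an identity quadratic in `X` and in `Y`. In `epq`, the digit `p` selects `X`
    -- among `∂_i`, `∂_l` and their sum, and `q` selects `Y` among `∂_j`, `∂_k` and their sum. The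
    -- mixed second difference of the nine identities is the symmetrized identity required.
    have e00 := h (Pi.single i 1) (Pi.single j 1)
    have e01 := h (Pi.single i 1) (Pi.single k 1)
    have e02 := h (Pi.single i 1) (Pi.single j 1 + Pi.single k 1)
    have e10 := h (Pi.single l 1) (Pi.single j 1)
    have e11 := h (Pi.single l 1) (Pi.single k 1)
    have e12 := h (Pi.single l 1) (Pi.single j 1 + Pi.single k 1)
    have e20 := h (Pi.single i 1 + Pi.single l 1) (Pi.single j 1)
    have e21 := h (Pi.single i 1 + Pi.single l 1) (Pi.single k 1)
    have e22 := h (Pi.single i 1 + Pi.single l 1) (Pi.single j 1 + Pi.single k 1)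
    simp only [Pi.add_apply, mul_add, add_mul, Finset.sum_add_distrib, Pi.single_apply, mul_ite,
      mul_one, mul_zero, Finset.sum_ite_eq', Finset.mem_univ, if_true,
      Matrix.mulVec_add, dotProduct_add, add_dotProduct, single_dotProduct,
      Matrix.mulVec_single_one, Matrix.col_apply, one_mul] at e00 e01 e02 e10 e11 e12 e20 e21 e22
    simp only [hs l i, hs k j, hs l j, hs l k, hs k i, hs j i] at e02 e10 e11 e12 e20 e21 e22 ⊢
    linear_combination e22 - e21 - e20 - e12 + e11 + e10 - e02 + e01 + e00

end Coord

namespace Coord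

variable {E : Type*} [NormedAddCommGroup E] [NormedSpace ℝ E] {n k l : ℕ}

/-! ### Warped products in coordinates -/

/-- On `V × U`, the matrix field `G` is the warped product metric `dt² + F(t)² H`. -/
structure IsWarpedOn (b : Module.Basis (Fin n) ℝ E) (H : E → Matrix (Fin n) (Fin n) ℝ)
    (U : Set E) (F : ℝ → ℝ) (V : Set ℝ) (B : Module.Basis (Fin (n + 1)) ℝ (ℝ × E))
    (G : ℝ × E → Matrix (Fin (n + 1)) (Fin (n + 1)) ℝ) : Prop where
  fiber : IsMetricOn H U
  isOpen_base : IsOpen V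
  smooth_warp : ContDiff ℝ ∞ F
  warp_pos : ∀ t, 0 < F t
  basis_zero : B 0 = (1, 0)
  basis_succ : ∀ i : Fin n, B i.succ = (0, b i)
  apply_zero_zero : ∀ y ∈ V ×ˢ U, G y 0 0 = 1
  apply_zero_succ : ∀ y ∈ V ×ˢ U, ∀ i : Fin n, G y 0 i.succ = 0
  apply_succ_zero : ∀ y ∈ V ×ˢ U, ∀ i : Fin n, G y i.succ 0 = 0
  apply_succ_succ : ∀ y ∈ V ×ˢ U, ∀ i j : Fin n, G y i.succ j.succ = F y.1 ^ 2 * H y.2 i j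

namespace IsWarpedOn

variable {b : Module.Basis (Fin n) ℝ E} {H : E → Matrix (Fin n) (Fin n) ℝ}
  {U : Set E} {F : ℝ → ℝ} {V : Set ℝ} {B : Module.Basis (Fin (n + 1)) ℝ (ℝ × E)}
  {G : ℝ × E → Matrix (Fin (n + 1)) (Fin (n + 1)) ℝ} (hW : IsWarpedOn b H U F V B G)
  {y : ℝ × E}

include hW

theorem isOpen : IsOpen (V ×ˢ U) := hW.isOpen_base.prod hW.fiber.isOpen

theorem hasDerivAt_warp (t : ℝ) : HasDerivAt F (deriv F t) t :=
  (hW.smooth_warp.differentiable (by simp) t).hasDerivAt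

theorem hasDerivAt_deriv_warp (t : ℝ) : HasDerivAt (deriv F) (deriv (deriv F) t) t :=
  ((contDiff_infty_iff_deriv.1 hW.smooth_warp).2.differentiable (by simp) t).hasDerivAt

/-- The metric and its Christoffel symbols all have components of the separated form `φ(t) k(x)`, so
this rule and its fiber analogue `pd_succ_mul` give every derivative needed. -/
theorem pd_zero_mul {φ : ℝ → ℝ} {φ' : ℝ} {k : E → ℝ} (hφ : HasDerivAt φ φ' y.1)
    (hk : DifferentiableAt ℝ k y.2) :
    pd B 0 (fun z => φ z.1 * k z.2) y = φ' * k y.2 := by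
  have h1 : HasFDerivAt (fun z : ℝ × E => φ z.1) _ y := hφ.hasFDerivAt.comp y hasFDerivAt_fst
  have h2 : HasFDerivAt (fun z : ℝ × E => k z.2) _ y := hk.hasFDerivAt.comp y hasFDerivAt_snd
  rw [pd, (h1.fun_mul h2).fderiv, hW.basis_zero]
  simp [mul_comm]

theorem pd_succ_mul {φ : ℝ → ℝ} {φ' : ℝ} {k : E → ℝ} (hφ : HasDerivAt φ φ' y.1)
    (hk : DifferentiableAt ℝ k y.2) (i : Fin n) :
    pd B i.succ (fun z => φ z.1 * k z.2) y = φ y.1 * pd b i k y.2 := by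
  have h1 : HasFDerivAt (fun z : ℝ × E => φ z.1) _ y := hφ.hasFDerivAt.comp y hasFDerivAt_fst
  have h2 : HasFDerivAt (fun z : ℝ × E => k z.2) _ y := hk.hasFDerivAt.comp y hasFDerivAt_snd
  rw [pd, (h1.fun_mul h2).fderiv, hW.basis_succ]
  simp [pd]

theorem pd_zero_snd {k : E → ℝ} (hk : DifferentiableAt ℝ k y.2) :
    pd B 0 (fun z => k z.2) y = 0 := by
  simpa using hW.pd_zero_mul (hasDerivAt_const y.1 (1 : ℝ)) hk

theorem pd_succ_snd {k : E → ℝ} (hk : DifferentiableAt ℝ k y.2) (i : Fin n) :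
    pd B i.succ (fun z => k z.2) y = pd b i k y.2 := by
  simpa using hW.pd_succ_mul (hasDerivAt_const y.1 (1 : ℝ)) hk i

variable (hy : y ∈ V ×ˢ U)
include hy

theorem pd_zero_zero (p : Fin (n + 1)) : pd B p (fun z => G z 0 0) y = 0 := by
  rw [pd_congr_of_eqOn B p hW.isOpen (v := fun _ => 1) hW.apply_zero_zero hy, pd_const]

theorem pd_zero_succ (p : Fin (n + 1)) (i : Fin n) : pd B p (fun z => G z 0 i.succ) y = 0 :=
  pd_eq_zero_of_eqOn B p hW.isOpen (fun z hz => hW.apply_zero_succ z hz i) hy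

theorem pd_succ_zero (p : Fin (n + 1)) (i : Fin n) : pd B p (fun z => G z i.succ 0) y = 0 :=
  pd_eq_zero_of_eqOn B p hW.isOpen (fun z hz => hW.apply_succ_zero z hz i) hy

theorem differentiableAt_fiber (i j : Fin n) : DifferentiableAt ℝ (fun z => H z i j) y.2 :=
  ((hW.fiber.smooth i j).contDiffAt (hW.fiber.isOpen.mem_nhds hy.2)).differentiableAt (by simp)

theorem differentiableAt_christoffel_fiber (m i j : Fin n) :
    DifferentiableAt ℝ (christoffel b H m i j) y.2 :=
  ((hW.fiber.contDiffOn_christoffel b m i j).contDiffAt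
    (hW.fiber.isOpen.mem_nhds hy.2)).differentiableAt (by simp)

theorem dt_succ_succ (i j : Fin n) :
    pd B 0 (fun z => G z i.succ j.succ) y = 2 * F y.1 * deriv F y.1 * H y.2 i j := by
  rw [pd_congr_of_eqOn B 0 hW.isOpen (fun z hz => hW.apply_succ_succ z hz i j) hy,
    hW.pd_zero_mul (φ := fun t => F t ^ 2) ((hW.hasDerivAt_warp y.1).pow 2)
      (hW.differentiableAt_fiber hy i j)]
  simp

theorem pd_succ_succ (p i j : Fin n) :
    pd B p.succ (fun z => G z i.succ j.succ) y = F y.1 ^ 2 * pd b p (fun z => H z i j) y.2 := by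
  rw [pd_congr_of_eqOn B p.succ hW.isOpen (fun z hz => hW.apply_succ_succ z hz i j) hy,
    hW.pd_succ_mul (φ := fun t => F t ^ 2) ((hW.hasDerivAt_warp y.1).pow 2)
      (hW.differentiableAt_fiber hy i j)]

omit hy in
theorem warp_ne_zero (t : ℝ) : F t ≠ 0 := (hW.warp_pos t).ne'

/-- The inverse of the warped product metric. -/
theorem inv_eq : (G y)⁻¹ = Matrix.of (Fin.cons (Fin.cons 1 fun _ => 0)
    fun i : Fin n => Fin.cons 0 fun j => (F y.1 ^ 2)⁻¹ * (H y.2)⁻¹ i j) := by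
  have hF := hW.warp_ne_zero y.1
  refine Matrix.inv_eq_right_inv ?_
  ext i j
  rw [Matrix.mul_apply, Fin.sum_univ_succ]
  refine Fin.cases ?_ (fun i => ?_) i <;> refine Fin.cases ?_ (fun j => ?_) j
  · simp [hW.apply_zero_zero y hy, hW.apply_zero_succ y hy]
  · simp [hW.apply_zero_zero y hy, hW.apply_zero_succ y hy,
      (Fin.succ_ne_zero j).symm]
  · simp [hW.apply_succ_zero y hy]
  · simp only [hW.apply_succ_zero y hy, hW.apply_succ_succ y hy, Matrix.of_apply, Fin.cons_succ,
      Fin.cons_zero, zero_mul, zero_add, Matrix.one_apply, Fin.succ_inj,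
      ← hW.fiber.mul_inv_apply hy.2 i j]
    refine Finset.sum_congr rfl fun m _ => ?_
    field_simp

theorem inv_zero_zero : (G y)⁻¹ 0 0 = 1 := by simp [hW.inv_eq hy]

theorem inv_zero_succ (i : Fin n) : (G y)⁻¹ 0 i.succ = 0 := by simp [hW.inv_eq hy]

theorem inv_succ_zero (i : Fin n) : (G y)⁻¹ i.succ 0 = 0 := by simp [hW.inv_eq hy]

theorem inv_succ_succ (i j : Fin n) :
    (G y)⁻¹ i.succ j.succ = (F y.1 ^ 2)⁻¹ * (H y.2)⁻¹ i j := by simp [hW.inv_eq hy]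

/-! #### Christoffel symbols -/

theorem christoffel_zero_zero_zero : christoffel B G 0 0 0 y = 0 := by
  simp [christoffel, Fin.sum_univ_succ, hW.inv_zero_zero hy, hW.inv_zero_succ hy,
    hW.pd_zero_zero hy]

theorem christoffel_zero_zero_succ (j : Fin n) : christoffel B G 0 0 j.succ y = 0 := by
  simp [christoffel, Fin.sum_univ_succ, hW.inv_zero_zero hy, hW.inv_zero_succ hy,
    hW.pd_zero_zero hy, hW.pd_zero_succ hy, hW.pd_succ_zero hy]

theorem christoffel_zero_succ_zero (i : Fin n) : christoffel B G 0 i.succ 0 y = 0 := by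
  simp [christoffel, Fin.sum_univ_succ, hW.inv_zero_zero hy, hW.inv_zero_succ hy,
    hW.pd_zero_zero hy, hW.pd_succ_zero hy]

theorem christoffel_zero_succ_succ (i j : Fin n) :
    christoffel B G 0 i.succ j.succ y = -(F y.1 * deriv F y.1) * H y.2 i j := by
  simp [christoffel, Fin.sum_univ_succ, hW.inv_zero_zero hy, hW.inv_zero_succ hy,
    hW.pd_succ_zero hy, hW.dt_succ_succ hy]
  ring

theorem christoffel_succ_zero_zero (m : Fin n) : christoffel B G m.succ 0 0 y = 0 := by
  simp [christoffel, Fin.sum_univ_succ, hW.inv_succ_zero hy, hW.pd_zero_zero hy,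
    hW.pd_zero_succ hy]

theorem christoffel_succ_zero_succ (m j : Fin n) :
    christoffel B G m.succ 0 j.succ y = deriv F y.1 / F y.1 * if m = j then 1 else 0 := by
  have hF := hW.warp_ne_zero y.1
  simp only [christoffel, Fin.sum_univ_succ, hW.inv_succ_zero hy, hW.pd_succ_zero hy,
    hW.pd_zero_succ hy, hW.dt_succ_succ hy, hW.inv_succ_succ hy, zero_mul, zero_add, add_zero,
    sub_zero, ← hW.fiber.inv_mul_apply hy.2 m j, Finset.mul_sum]
  refine Finset.sum_congr rfl fun l _ => ?_
  rw [hW.fiber.symm y.2 hy.2 j l]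
  field_simp

theorem christoffel_succ_succ_zero (m i : Fin n) :
    christoffel B G m.succ i.succ 0 y = deriv F y.1 / F y.1 * if m = i then 1 else 0 := by
  rw [← hW.christoffel_succ_zero_succ hy]
  simp only [christoffel, Fin.sum_univ_succ, hW.inv_succ_zero hy, hW.pd_succ_zero hy,
    hW.pd_zero_succ hy, zero_mul, zero_add, add_zero]

theorem christoffel_succ_succ_succ (m i j : Fin n) :
    christoffel B G m.succ i.succ j.succ y = christoffel b H m i j y.2 := by
  have hF := hW.warp_ne_zero y.1
  simp only [christoffel, Fin.sum_univ_succ, hW.inv_succ_zero hy, hW.inv_succ_succ hy,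
    hW.pd_succ_succ hy, zero_mul, zero_add]
  congr 1
  refine Finset.sum_congr rfl fun l _ => ?_
  field_simp

/-! #### Derivatives of the Christoffel symbols -/

theorem pd_christoffel_zero_zero_zero (p : Fin (n + 1)) :
    pd B p (christoffel B G 0 0 0) y = 0 :=
  pd_eq_zero_of_eqOn B p hW.isOpen (fun _ hz => hW.christoffel_zero_zero_zero hz) hy

theorem pd_christoffel_zero_zero_succ (p : Fin (n + 1)) (j : Fin n) :
    pd B p (christoffel B G 0 0 j.succ) y = 0 :=
  pd_eq_zero_of_eqOn B p hW.isOpen (fun _ hz => hW.christoffel_zero_zero_succ hz j) hy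

theorem pd_christoffel_zero_succ_zero (p : Fin (n + 1)) (j : Fin n) :
    pd B p (christoffel B G 0 j.succ 0) y = 0 :=
  pd_eq_zero_of_eqOn B p hW.isOpen (fun _ hz => hW.christoffel_zero_succ_zero hz j) hy

theorem pd_christoffel_succ_zero_zero (p : Fin (n + 1)) (j : Fin n) :
    pd B p (christoffel B G j.succ 0 0) y = 0 :=
  pd_eq_zero_of_eqOn B p hW.isOpen (fun _ hz => hW.christoffel_succ_zero_zero hz j) hy

omit hy in
theorem hasDerivAt_mul_deriv (t : ℝ) : HasDerivAt (fun t => -(F t * deriv F t))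
    (-(deriv F t * deriv F t + F t * deriv (deriv F) t)) t :=
  ((hW.hasDerivAt_warp t).mul (hW.hasDerivAt_deriv_warp t)).neg

omit hy in
theorem hasDerivAt_deriv_div (t : ℝ) : HasDerivAt (fun t => deriv F t / F t)
    ((deriv (deriv F) t * F t - deriv F t * deriv F t) / F t ^ 2) t :=
  (hW.hasDerivAt_deriv_warp t).div (hW.hasDerivAt_warp t) (hW.warp_ne_zero t)

theorem dt_christoffel_zero_succ_succ (i j : Fin n) :
    pd B 0 (christoffel B G 0 i.succ j.succ) y
      = -(deriv F y.1 * deriv F y.1 + F y.1 * deriv (deriv F) y.1) * H y.2 i j := by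
  rw [pd_congr_of_eqOn B 0 hW.isOpen (fun z hz => hW.christoffel_zero_succ_succ hz i j) hy,
    hW.pd_zero_mul (hW.hasDerivAt_mul_deriv y.1) (hW.differentiableAt_fiber hy i j)]

theorem pd_christoffel_zero_succ_succ (p i j : Fin n) :
    pd B p.succ (christoffel B G 0 i.succ j.succ) y
      = -(F y.1 * deriv F y.1) * pd b p (fun z => H z i j) y.2 := by
  rw [pd_congr_of_eqOn B p.succ hW.isOpen (fun z hz => hW.christoffel_zero_succ_succ hz i j) hy,
    hW.pd_succ_mul (hW.hasDerivAt_mul_deriv y.1) (hW.differentiableAt_fiber hy i j)]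

theorem dt_christoffel_succ_zero_succ (m j : Fin n) :
    pd B 0 (christoffel B G m.succ 0 j.succ) y
      = (deriv (deriv F) y.1 * F y.1 - deriv F y.1 * deriv F y.1) / F y.1 ^ 2 *
        if m = j then 1 else 0 := by
  rw [pd_congr_of_eqOn B 0 hW.isOpen (fun z hz => hW.christoffel_succ_zero_succ hz m j) hy,
    hW.pd_zero_mul (k := fun _ => if m = j then 1 else 0) (hW.hasDerivAt_deriv_div y.1)
      (differentiableAt_const _)]

theorem pd_christoffel_succ_zero_succ (p m j : Fin n) :
    pd B p.succ (christoffel B G m.succ 0 j.succ) y = 0 := by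
  rw [pd_congr_of_eqOn B p.succ hW.isOpen (fun z hz => hW.christoffel_succ_zero_succ hz m j) hy,
    hW.pd_succ_mul (k := fun _ => if m = j then 1 else 0) (hW.hasDerivAt_deriv_div y.1)
      (differentiableAt_const _), pd_const, mul_zero]

theorem pd_christoffel_succ_succ_zero (p : Fin (n + 1)) (m i : Fin n) :
    pd B p (christoffel B G m.succ i.succ 0) y = pd B p (christoffel B G m.succ 0 i.succ) y :=
  pd_congr_of_eqOn B p hW.isOpen (fun z hz => by
    rw [hW.christoffel_succ_zero_succ hz, hW.christoffel_succ_succ_zero hz]) hy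

theorem dt_christoffel_succ_succ_succ (m i j : Fin n) :
    pd B 0 (christoffel B G m.succ i.succ j.succ) y = 0 := by
  rw [pd_congr_of_eqOn B 0 hW.isOpen (fun z hz => hW.christoffel_succ_succ_succ hz m i j) hy,
    hW.pd_zero_snd (hW.differentiableAt_christoffel_fiber hy m i j)]

theorem pd_christoffel_succ_succ_succ (p m i j : Fin n) :
    pd B p.succ (christoffel B G m.succ i.succ j.succ) y
      = pd b p (christoffel b H m i j) y.2 := by
  rw [pd_congr_of_eqOn B p.succ hW.isOpen (fun z hz => hW.christoffel_succ_succ_succ hz m i j) hy,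
    hW.pd_succ_snd (hW.differentiableAt_christoffel_fiber hy m i j)]

/-! #### Curvature -/

omit hW hy in
theorem _root_.Coord.riemUp_antisymm (m i j k : Fin n) (b : Module.Basis (Fin n) ℝ E)
    (G : E → Matrix (Fin n) (Fin n) ℝ) (y : E) : riemUp b G m i j k y = -riemUp b G m j i k y := by
  simp only [riemUp, Finset.sum_sub_distrib]
  ring

omit hW hy in
theorem _root_.Coord.riemUp_self (m i k : Fin n) (b : Module.Basis (Fin n) ℝ E)
    (G : E → Matrix (Fin n) (Fin n) ℝ) (y : E) : riemUp b G m i i k y = 0 := by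
  simp [riemUp]

/-- Up to antisymmetry in the first two lower indices, which also kills the case of two zeros there,
the curvature has eight types of components; they are treated one by one from here on. -/
theorem riemUp_zero_zero_succ_zero (j : Fin n) : riemUp B G 0 0 j.succ 0 y = 0 := by
  simp [riemUp, Fin.sum_univ_succ, hW.pd_christoffel_zero_succ_zero hy,
    hW.pd_christoffel_zero_zero_zero hy, hW.christoffel_zero_zero_zero hy,
    hW.christoffel_zero_zero_succ hy, hW.christoffel_zero_succ_zero hy,
    hW.christoffel_succ_zero_zero hy]

theorem riemUp_zero_zero_succ_succ (j k : Fin n) :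
    riemUp B G 0 0 j.succ k.succ y = -(F y.1 * deriv (deriv F) y.1) * H y.2 j k := by
  have hF := hW.warp_ne_zero y.1
  simp [riemUp, Fin.sum_univ_succ, hW.dt_christoffel_zero_succ_succ hy,
    hW.pd_christoffel_zero_zero_succ hy, hW.christoffel_zero_zero_zero hy,
    hW.christoffel_zero_zero_succ hy, hW.christoffel_zero_succ_zero hy,
    hW.christoffel_zero_succ_succ hy, hW.christoffel_succ_zero_succ hy]
  field_simp
  ring

theorem riemUp_zero_succ_succ_zero (i j : Fin n) : riemUp B G 0 i.succ j.succ 0 y = 0 := by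
  simp [riemUp, Fin.sum_univ_succ, hW.pd_christoffel_zero_succ_zero hy,
    hW.christoffel_zero_succ_zero hy,
    hW.christoffel_zero_succ_succ hy, hW.christoffel_succ_succ_zero hy,
    hW.fiber.symm y.2 hy.2 j i]

/-- The Codazzi equation: the second fundamental form of a fiber is a multiple, constant along the
fiber, of the fiber metric, and that metric is parallel. -/
theorem riemUp_zero_succ_succ_succ (i j k : Fin n) :
    riemUp B G 0 i.succ j.succ k.succ y = 0 := by
  have hs : ∑ x, H y.2 k x * christoffel b H x j i y.2
      = ∑ x, H y.2 k x * christoffel b H x i j y.2 :=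
    Finset.sum_congr rfl fun x _ => by rw [hW.fiber.christoffel_symm b hy.2 x j i]
  simp only [riemUp, Fin.sum_univ_succ, hW.pd_christoffel_zero_succ_succ hy,
    hW.christoffel_zero_succ_zero hy, hW.christoffel_zero_succ_succ hy,
    hW.christoffel_succ_succ_succ hy, hW.fiber.pd_eq_lowerChristoffel_add b hy.2,
    ← hW.fiber.sum_mul_christoffel b hy.2, mul_assoc, Finset.sum_sub_distrib, ← Finset.mul_sum]
  rw [hs]
  ring

theorem riemUp_succ_zero_succ_zero (m j : Fin n) : riemUp B G m.succ 0 j.succ 0 y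
    = deriv (deriv F) y.1 / F y.1 * if m = j then 1 else 0 := by
  have hF := hW.warp_ne_zero y.1
  simp [riemUp, Fin.sum_univ_succ, hW.pd_christoffel_succ_succ_zero hy,
    hW.dt_christoffel_succ_zero_succ hy, hW.pd_christoffel_succ_zero_zero hy,
    hW.christoffel_succ_zero_zero hy, hW.christoffel_zero_zero_zero hy,
    hW.christoffel_succ_zero_succ hy, hW.christoffel_succ_succ_zero hy]
  split_ifs
  · field_simp
    ring
  · simp

theorem riemUp_succ_zero_succ_succ (m j k : Fin n) : riemUp B G m.succ 0 j.succ k.succ y = 0 := by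
  simp [riemUp, Fin.sum_univ_succ, hW.pd_christoffel_succ_zero_succ hy,
    hW.dt_christoffel_succ_succ_succ hy, hW.christoffel_succ_zero_zero hy,
    hW.christoffel_zero_zero_succ hy,
    hW.christoffel_succ_zero_succ hy, hW.christoffel_succ_succ_succ hy]
  ring

theorem riemUp_succ_succ_succ_zero (m i j : Fin n) : riemUp B G m.succ i.succ j.succ 0 y = 0 := by
  simp [riemUp, Fin.sum_univ_succ, hW.pd_christoffel_succ_succ_zero hy,
    hW.pd_christoffel_succ_zero_succ hy, hW.christoffel_zero_succ_zero hy,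
    hW.christoffel_succ_succ_zero hy, hW.christoffel_succ_succ_succ hy,
    hW.fiber.christoffel_symm b hy.2 m j i]

/-- The Gauss equation. The correction comes from the products `Γ^m_{i0} Γ^0_{jk}`, in which the
powers of `F` cancel and leave `F'²`. -/
theorem riemUp_succ_succ_succ_succ (m i j k : Fin n) :
    riemUp B G m.succ i.succ j.succ k.succ y = riemUp b H m i j k y.2
      - deriv F y.1 ^ 2 * ((if m = i then 1 else 0) * H y.2 j k
        - (if m = j then 1 else 0) * H y.2 i k) := by
  have hF := hW.warp_ne_zero y.1
  simp only [riemUp, Fin.sum_univ_succ, hW.pd_christoffel_succ_succ_succ hy,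
    hW.christoffel_succ_succ_zero hy, hW.christoffel_zero_succ_succ hy,
    hW.christoffel_succ_succ_succ hy]
  field_simp
  ring

end IsWarpedOn

end Coord

/-! ### Ricci, scalar and Weyl curvature of a warped product with fibers of constant curvature -/

namespace Coord

variable {E : Type*} [NormedAddCommGroup E] [NormedSpace ℝ E] {n k l : ℕ}

theorem IsMetricOn.riemUp_of_riem {G : E → Matrix (Fin n) (Fin n) ℝ} {U : Set E}
    (hG : IsMetricOn G U) (b : Module.Basis (Fin n) ℝ E) {y : E} (hy : y ∈ U) {κ : ℝ}
    (h : ∀ i j k l, riem b G i j k l y = κ * (G y j k * G y i l - G y i k * G y j l))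
    (m i j k : Fin n) :
    riemUp b G m i j k y = κ * ((if m = i then 1 else 0) * G y j k
      - (if m = j then 1 else 0) * G y i k) := by
  have h1 : ∑ l, riem b G i j k l y * (G y)⁻¹ l m = riemUp b G m i j k y := by
    simp only [riem, Finset.sum_mul]
    rw [Finset.sum_comm]
    simp only [mul_assoc, ← Finset.mul_sum, hG.mul_inv_apply hy]
    simp
  rw [← h1]
  simp only [h, eq_comm (a := m), ← hG.mul_inv_apply hy, Finset.sum_mul, mul_sub,
    ← Finset.sum_sub_distrib, Finset.mul_sum]
  exact Finset.sum_congr rfl fun l _ => by ring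

theorem covD_eq_zero (b : Module.Basis (Fin n) ℝ E) (G : E → Matrix (Fin n) (Fin n) ℝ)
    {S : (Fin k → Fin n) → E → ℝ} {W : Set E} (hW : IsOpen W) (hS : ∀ I, ∀ y ∈ W, S I y = 0)
    (J : Fin (k + 1) → Fin n) : ∀ y ∈ W, covD b G S J y = 0 := by
  intro y hy
  rw [covD, pd_eq_zero_of_eqOn b _ hW (hS _) hy]
  simp [hS _ y hy]

/-- The Bach tensor vanishes where the Weyl tensor vanishes. -/
theorem bach_eq_zero (b : Module.Basis (Fin n) ℝ E) (G : E → Matrix (Fin n) (Fin n) ℝ)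
    {W : Set E} (hW : IsOpen W) (h : ∀ I, ∀ y ∈ W, weyl b G I y = 0) (i j : Fin n)
    {y : E} (hy : y ∈ W) : bach b G i j y = 0 := by
  simp [bach, h _ y hy, covD_eq_zero b G hW (covD_eq_zero b G hW h) _ y hy]

namespace IsWarpedOn

variable {b : Module.Basis (Fin n) ℝ E} {H : E → Matrix (Fin n) (Fin n) ℝ}
  {U : Set E} {F : ℝ → ℝ} {V : Set ℝ} {B : Module.Basis (Fin (n + 1)) ℝ (ℝ × E)}
  {G : ℝ × E → Matrix (Fin (n + 1)) (Fin (n + 1)) ℝ} (hW : IsWarpedOn b H U F V B G)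
  {y : ℝ × E} (hy : y ∈ V ×ˢ U) {κ : ℝ}
  (hκ : ∀ z ∈ U, ∀ i j k l, riem b H i j k l z = κ * (H z j k * H z i l - H z i k * H z j l))

include hW hy

theorem riem_last_zero (i j k : Fin (n + 1)) : riem B G i j k 0 y = riemUp B G 0 i j k y := by
  simp [riem, Fin.sum_univ_succ, hW.apply_zero_zero y hy, hW.apply_succ_zero y hy]

theorem riem_last_succ (i j k : Fin (n + 1)) (l : Fin n) :
    riem B G i j k l.succ y = ∑ m : Fin n, riemUp B G m.succ i j k y * (F y.1 ^ 2 * H y.2 m l) := by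
  simp [riem, Fin.sum_univ_succ, hW.apply_zero_succ y hy, hW.apply_succ_succ y hy]

theorem ric_zero_zero : ric B G 0 0 y = -(n * (deriv (deriv F) y.1 / F y.1)) := by
  simp only [ric, Fin.sum_univ_succ, riemUp_self, riemUp_antisymm _ (Fin.succ _) 0,
    hW.riemUp_succ_zero_succ_zero hy]
  simp

theorem ric_zero_succ (j : Fin n) : ric B G 0 j.succ y = 0 := by
  simp only [ric, Fin.sum_univ_succ, riemUp_self, riemUp_antisymm _ (Fin.succ _) 0,
    hW.riemUp_succ_zero_succ_succ hy]
  simp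

theorem ric_succ_zero (j : Fin n) : ric B G j.succ 0 y = 0 := by
  simp [ric, Fin.sum_univ_succ, hW.riemUp_zero_zero_succ_zero hy,
    hW.riemUp_succ_succ_succ_zero hy]

include hκ

theorem riemUp_succ_of_riem (m i j k : Fin n) :
    riemUp B G m.succ i.succ j.succ k.succ y = (κ - deriv F y.1 ^ 2) *
      ((if m = i then 1 else 0) * H y.2 j k - (if m = j then 1 else 0) * H y.2 i k) := by
  rw [hW.riemUp_succ_succ_succ_succ hy, hW.fiber.riemUp_of_riem b hy.2 (hκ y.2 hy.2)]
  ring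

theorem ric_succ_succ (i j : Fin n) : ric B G i.succ j.succ y =
    (-(F y.1 * deriv (deriv F) y.1) + (n - 1) * (κ - deriv F y.1 ^ 2)) * H y.2 i j := by
  simp only [ric, Fin.sum_univ_succ, hW.riemUp_zero_zero_succ_succ hy,
    hW.riemUp_succ_of_riem hy hκ, ← Finset.mul_sum, Finset.sum_sub_distrib]
  simp
  ring

theorem scal_eq : scal B G y = -(n * (deriv (deriv F) y.1 / F y.1)) +
    n * (F y.1 ^ 2)⁻¹ * (-(F y.1 * deriv (deriv F) y.1) + (n - 1) * (κ - deriv F y.1 ^ 2)) := by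
  have h : ∀ i : Fin n, ∑ j, (H y.2)⁻¹ i j * H y.2 i j = 1 := by
    intro i
    have h0 := hW.fiber.inv_mul_apply hy.2 i i
    rw [if_pos rfl] at h0
    rw [← h0]
    exact Finset.sum_congr rfl fun j _ => by rw [hW.fiber.symm y.2 hy.2 i j]
  have h2 : ∀ c d : ℝ, ∑ i, ∑ j, c * (H y.2)⁻¹ i j * (d * H y.2 i j) = n * c * d := by
    intro c d
    have : ∀ i, ∑ j, c * (H y.2)⁻¹ i j * (d * H y.2 i j) = c * d := by
      intro i
      rw [← mul_one (c * d), ← h i, Finset.mul_sum]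
      exact Finset.sum_congr rfl fun j _ => by ring
    simp [this]
    ring
  simp only [scal, Fin.sum_univ_succ, hW.inv_zero_zero hy, hW.inv_zero_succ hy,
    hW.inv_succ_zero hy, hW.inv_succ_succ hy, hW.ric_zero_zero hy, hW.ric_succ_succ hy hκ,
    zero_mul, Finset.sum_const_zero, add_zero, zero_add, h2, one_mul]

/-- The fiber components of the Einstein tensor are proportional to the fiber metric. -/
theorem einstein_succ_succ : ∃ c : ℝ, ∀ i j : Fin n, einstein B G i.succ j.succ y = c * H y.2 i j :=
  ⟨_, fun i j => by
    rw [einstein, hW.ric_succ_succ hy hκ, hW.apply_succ_succ y hy, ← mul_assoc, ← sub_mul]⟩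

omit hκ
variable {b : Module.Basis (Fin 3) ℝ E} {H : E → Matrix (Fin 3) (Fin 3) ℝ}
  {U : Set E} {F : ℝ → ℝ} {V : Set ℝ} {B : Module.Basis (Fin 4) ℝ (ℝ × E)}
  {G : ℝ × E → Matrix (Fin 4) (Fin 4) ℝ} {κ : ℝ}

omit hW hy in
/-- A four-dimensional warped product over an interval with fibers of constant curvature has
vanishing Weyl tensor. -/
theorem weyl_eq_zero (hW : IsWarpedOn b H U F V B G) (hκ : ∀ z ∈ U, ∀ i j k l,
      riem b H i j k l z = κ * (H z j k * H z i l - H z i k * H z j l))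
    (I : Fin 4 → Fin 4) : ∀ y ∈ V ×ˢ U, weyl B G I y = 0 := by
  intro y hy
  have hF := hW.warp_ne_zero y.1
  have hd : ∀ (c : ℝ) (i l : Fin 3), ∑ m, c * (if m = i then 1 else 0) * (F y.1 ^ 2 * H y.2 m l)
      = c * (F y.1 ^ 2 * H y.2 i l) := by
    intro c i l
    simp
  have hd2 : ∀ (i j k l : Fin 3), ∑ m, (κ - deriv F y.1 ^ 2) * ((if m = i then 1 else 0) * H y.2 j k
      - (if m = j then 1 else 0) * H y.2 i k) * (F y.1 ^ 2 * H y.2 m l)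
      = (κ - deriv F y.1 ^ 2) * (H y.2 j k * (F y.1 ^ 2 * H y.2 i l)
        - H y.2 i k * (F y.1 ^ 2 * H y.2 j l)) := by
    intro i j k l
    simp [mul_sub, sub_mul, Finset.sum_sub_distrib]
    ring
  rw [weyl, hW.scal_eq hy hκ]
  generalize I 0 = i
  generalize I 1 = j
  generalize I 2 = k
  generalize I 3 = l
  -- Each index is either `t` or a fiber direction. In each of the sixteen cases the curvature
  -- formulas leave a rational identity in `F`, its derivatives, `κ` and the entries of `H`.
  induction i using Fin.cases <;> induction j using Fin.cases <;> induction k using Fin.cases <;>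
  induction l using Fin.cases <;>
  simp only [hW.riem_last_zero hy, hW.riem_last_succ hy, riemUp_self,
    riemUp_antisymm _ (Fin.succ _) 0, hW.riemUp_zero_zero_succ_zero hy,
    hW.riemUp_zero_zero_succ_succ hy, hW.riemUp_zero_succ_succ_zero hy,
    hW.riemUp_zero_succ_succ_succ hy, hW.riemUp_succ_zero_succ_zero hy,
    hW.riemUp_succ_zero_succ_succ hy, hW.riemUp_succ_succ_succ_zero hy,
    hW.riemUp_succ_of_riem hy hκ, hd, hd2, neg_mul, Finset.sum_neg_distrib, neg_zero, zero_mul,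
    Finset.sum_const_zero, hW.ric_zero_zero hy, hW.ric_zero_succ hy, hW.ric_succ_zero hy,
    hW.ric_succ_succ hy hκ, hW.apply_zero_zero y hy, hW.apply_zero_succ y hy,
    hW.apply_succ_zero y hy, hW.apply_succ_succ y hy, mul_zero, sub_zero, add_zero]
  all_goals push_cast
  all_goals field_simp
  all_goals ring

end IsWarpedOn

end Coord

/-! ### The dual form `*T`, its differential, and the rank argument -/

namespace Coord

variable {E : Type*} [NormedAddCommGroup E] [NormedSpace ℝ E] {n k l : ℕ}

theorem extD_eq_zero (b : Module.Basis (Fin n) ℝ E) {σ : (Fin k → Fin n) → E → ℝ} {W : Set E}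
    (hW : IsOpen W) (h : ∀ J, ∀ y ∈ W, σ J y = 0) (J : Fin (k + 1) → Fin n) {y : E} (hy : y ∈ W) :
    extD b σ J y = 0 := by
  rw [extD]
  exact Finset.sum_eq_zero fun a _ => by rw [pd_eq_zero_of_eqOn b _ hW (h _) hy, mul_zero]

omit [NormedAddCommGroup E] [NormedSpace ℝ E] in
theorem hodge_eq_zero (h : n = k + l) (G : E → Matrix (Fin n) (Fin n) ℝ)
    {σ : (Fin k → Fin n) → E → ℝ} {y : E} (hσ : ∀ J, σ J y = 0) (J : Fin l → Fin n) :
    hodge h G σ J y = 0 := by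
  simp [hodge, hσ]

/-- The Levi-Civita symbol vanishes on families of indices that omit a value. -/
theorem leviCivita_eq_zero {I : Fin n → Fin n} {c : Fin n} (h : ∀ a, I a ≠ c) :
    leviCivita I = 0 :=
  Matrix.det_eq_zero_of_column_eq_zero c fun a => by simp [h a]

theorem extD_one_form (b : Module.Basis (Fin n) ℝ E) (σ : (Fin 1 → Fin n) → E → ℝ)
    (J : Fin 2 → Fin n) (y : E) :
    extD b σ J y = pd b (J 0) (σ fun _ => J 1) y - pd b (J 1) (σ fun _ => J 0) y := by
  have h0 : (0 : Fin 2).removeNth J = fun _ => J 1 := by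
    ext a
    fin_cases a
    rfl
  have h1 : (1 : Fin 2).removeNth J = fun _ => J 0 := by
    ext a
    fin_cases a
    rfl
  change ∑ a : Fin 2, (-1 : ℝ) ^ (a : ℕ) * pd b (J a) (σ (a.removeNth J)) y = _
  rw [Fin.sum_univ_two, h0, h1]
  simp only [Fin.val_zero, Fin.val_one, pow_zero, pow_one]
  ring

/-- A positive definite matrix of size at least two is not a multiple of a dyad. -/
theorem eq_zero_of_posDef_add_dyad {A : Matrix (Fin n) (Fin n) ℝ} (hA : A.PosDef) (hn : 2 ≤ n)
    {c d : ℝ} (hd : d ≠ 0) {a : Fin n → ℝ} (h : ∀ i j, c * A i j + d * (a i * a j) = 0)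
    (i : Fin n) : a i = 0 := by
  obtain ⟨v, hv, hav⟩ : ∃ v : Fin n → ℝ, v ≠ 0 ∧ a ⬝ᵥ v = 0 := by
    -- The entries of `a` are at least two vectors of the one-dimensional space `ℝ`; a nontrivial
    -- linear relation between them is a nonzero `v` with `a ⬝ᵥ v = 0`.
    have : ¬ LinearIndependent ℝ a := by
      intro hli
      have := hli.fintype_card_le_finrank
      simp at this
      omega
    obtain ⟨g, hg, i, hi⟩ := Fintype.not_linearIndependent_iff.1 this
    refine ⟨g, fun h0 => hi (by rw [h0]; rfl), ?_⟩
    rw [dotProduct_comm]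
    simpa [dotProduct] using hg
  have hq := hA.dotProduct_mulVec_pos hv
  rw [star_trivial] at hq
  -- On `v` the dyad vanishes, so only the positive definite part is left.
  have hc : c * (v ⬝ᵥ A.mulVec v) = 0 := by
    have : c * (v ⬝ᵥ A.mulVec v) + d * ((a ⬝ᵥ v) * (a ⬝ᵥ v)) = 0 := by
      rw [dotProduct, dotProduct, Finset.sum_mul_sum]
      simp only [dotProduct, Matrix.mulVec, Finset.mul_sum, ← Finset.sum_add_distrib]
      exact Finset.sum_eq_zero fun p _ => Finset.sum_eq_zero fun q _ => by
        linear_combination v p * v q * h p q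
    simpa [hav] using this
  have hc0 : c = 0 := (mul_eq_zero.1 hc).resolve_right hq.ne'
  have := h i i
  simpa [hc0, hd] using this

namespace IsWarpedOn

variable {b : Module.Basis (Fin 3) ℝ E} {H : E → Matrix (Fin 3) (Fin 3) ℝ}
  {U : Set E} {F : ℝ → ℝ} {V : Set ℝ} {B : Module.Basis (Fin 4) ℝ (ℝ × E)}
  {G : ℝ × E → Matrix (Fin 4) (Fin 4) ℝ} (hW : IsWarpedOn b H U F V B G)
  {T : (Fin 3 → Fin 4) → ℝ × E → ℝ} (hT : ∀ y ∈ V ×ˢ U, ∀ J, (∃ a, J a = 0) → T J y = 0)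

include hW hT

/-- The Hodge dual of a multiple of the fiber volume form is a multiple of `dt`. -/
theorem hodge_succ_eq_zero {J : Fin 1 → Fin 4} (hJ : J 0 ≠ 0) :
    ∀ y ∈ V ×ˢ U, hodge (k := 3) (l := 1) rfl G T J y = 0 := by
  intro y hy
  rw [hodge]
  refine mul_eq_zero_of_right _ (Finset.sum_eq_zero fun I _ => Finset.sum_eq_zero fun M _ => ?_)
  -- A nonzero summand needs `M` free of `0`, by `hT`, and then `I` free of `0`, because the inverse
  -- metric is block diagonal. But then `I` followed by `J` omits the value `0`, and the Levi-Civita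
  -- symbol vanishes.
  by_cases hM : ∃ a, M a = 0
  · simp [hT y hy M hM]
  by_cases hI : ∃ a, I a = 0
  · obtain ⟨a, ha⟩ := hI
    obtain ⟨m, hm⟩ := Fin.exists_succ_eq.2 (not_exists.1 hM a)
    rw [Finset.prod_eq_zero (Finset.mem_univ a), zero_mul, zero_mul]
    rw [ha, ← hm, hW.inv_zero_succ hy]
  · rw [leviCivita_eq_zero (c := 0), mul_zero]
    intro a
    simp only [Function.comp_apply, Fin.cast_eq_self]
    refine Fin.addCases (m := 3) (n := 1) (fun a => ?_) (fun a => ?_) a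
    · rw [Fin.append_left]
      exact fun h => hI ⟨a, h⟩
    · rw [Fin.append_right, Subsingleton.elim a 0]
      exact hJ

/-- The fiber components of `*T` vanish on an open set, so their derivatives vanish too. -/
theorem extD_hodge_succ_succ (i j : Fin 3) {y : ℝ × E} (hy : y ∈ V ×ˢ U) {J : Fin 2 → Fin 4}
    (h0 : J 0 = i.succ) (h1 : J 1 = j.succ) :
    extD B (hodge (k := 3) (l := 1) rfl G T) J y = 0 := by
  rw [extD_one_form, h0, h1,
    pd_eq_zero_of_eqOn B _ hW.isOpen (hW.hodge_succ_eq_zero hT (Fin.succ_ne_zero j)) hy,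
    pd_eq_zero_of_eqOn B _ hW.isOpen (hW.hodge_succ_eq_zero hT (Fin.succ_ne_zero i)) hy, sub_zero]

/-- The differential of the Hodge dual vanishes as soon as its mixed components do. -/
theorem extD_hodge_eq_zero {y : ℝ × E} (hy : y ∈ V ×ˢ U)
    (h : ∀ i : Fin 3, extD B (hodge (k := 3) (l := 1) rfl G T)
      (Fin.cons i.succ fun _ => 0 : Fin 2 → Fin 4) y = 0) (J : Fin 2 → Fin 4) :
    extD B (hodge (k := 3) (l := 1) rfl G T) J y = 0 := by
  obtain h0 | ⟨i, h0⟩ := Fin.eq_zero_or_eq_succ (J 0) <;>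
    obtain h1 | ⟨j, h1⟩ := Fin.eq_zero_or_eq_succ (J 1)
  · rw [extD_one_form, h0, h1, sub_self]
  · have := h j
    rw [extD_one_form] at this ⊢
    rw [h0, h1]
    simp only [Fin.cons_zero, Fin.cons_one] at this
    linarith
  · have := h i
    rw [extD_one_form] at this ⊢
    rw [h0, h1]
    simpa only [Fin.cons_zero, Fin.cons_one] using this
  · exact hW.extD_hodge_succ_succ hT i j hy h0 h1

theorem gForm_hodge_succ_succ (i j : Fin 3) {y : ℝ × E} (hy : y ∈ V ×ˢ U) :
    gForm (k := 0) G (hodge (k := 3) (l := 1) rfl G T) i.succ j.succ y = 0 := by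
  have : ∀ M, hodge (k := 3) (l := 1) rfl G T (Fin.cons i.succ M : Fin 1 → Fin 4) y = 0 :=
    fun M => hW.hodge_succ_eq_zero hT (by simp) y hy
  simp [gForm, this]

/-- The contraction of `d*T` with a fiber vector is a multiple of `dt`, which has unit length, so
the scalar product reduces to one product of coefficients. This is the dyad of the rank argument. -/
theorem gForm_extD_hodge_succ_succ (i j : Fin 3) {y : ℝ × E} (hy : y ∈ V ×ˢ U) :
    gForm (k := 1) G (extD B (hodge (k := 3) (l := 1) rfl G T)) i.succ j.succ y =
      extD B (hodge (k := 3) (l := 1) rfl G T) (Fin.cons i.succ fun _ => 0 : Fin 2 → Fin 4) y *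
      extD B (hodge (k := 3) (l := 1) rfl G T) (Fin.cons j.succ fun _ => 0 : Fin 2 → Fin 4) y := by
  have key : ∀ (i : Fin 3) (I : Fin 1 → Fin 4), I ≠ (fun _ => 0) →
      extD B (hodge (k := 3) (l := 1) rfl G T) (Fin.cons i.succ I : Fin 2 → Fin 4) y = 0 := by
    intro i I hI
    have h0 : I 0 ≠ 0 := fun h => hI (by
      ext a
      rw [Subsingleton.elim a 0, h])
    obtain ⟨m, hm⟩ := Fin.exists_succ_eq.2 h0
    exact hW.extD_hodge_succ_succ hT i m hy (by simp) (by simp [hm])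
  rw [gForm, Finset.sum_eq_single (fun _ => 0), Finset.sum_eq_single (fun _ => 0)]
  · simp [hW.inv_zero_zero hy]
  · intro M _ hM
    rw [key j M hM, mul_zero]
  · simp
  · intro I _ hI
    exact Finset.sum_eq_zero fun M _ => by rw [key i I hI, mul_zero, zero_mul]
  · simp

/-- Solutions of the equations of motion on a warped product chart, with torsion proportional to
the fiber volume form, have vanishing torsion. -/
theorem torsion_eq_zero {κ : ℝ} (hpos : ∀ z ∈ U, (H z).PosDef)
    (hκ : ∀ z ∈ U, ∀ i j k l, riem b H i j k l z = κ * (H z j k * H z i l - H z i k * H z j l))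
    {α β γ₁ γ₂ : ℝ} (hγ₁ : γ₁ ≠ 0) (hγ₂ : γ₂ ≠ 0)
    (h1 : ∀ y ∈ V ×ˢ U, ∀ J, torsionEq γ₁ γ₂ B G T J y = 0)
    (h2 : ∀ y ∈ V ×ˢ U, ∀ i j, metricEq α β γ₁ γ₂ B G T i j y = 0) :
    ∀ y ∈ V ×ˢ U, ∀ J, T J y = 0 := by
  have hω : ∀ y ∈ V ×ˢ U, ∀ J, extD B (hodge (k := 3) (l := 1) rfl G T) J y = 0 := by
    intro y hy
    refine hW.extD_hodge_eq_zero hT hy ?_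
    obtain ⟨c, hc⟩ := hW.einstein_succ_succ hy hκ
    -- Here `c` collects all coefficients of `H` in the fiber block: the Einstein part and the two
    -- norm terms, for which `g = F² H`. The coefficient `2 γ₂` of the dyad is `-γ₂ · (-2)`.
    refine eq_zero_of_posDef_add_dyad (hpos y.2 hy.2) (by norm_num)
      (c := α * c + γ₁ * ((1 / 2) * normSq G T y * F y.1 ^ 2)
        - γ₂ * ((1 / 2) * normSq G (codiff B G T) y * F y.1 ^ 2))
      (d := 2 * γ₂) (by simpa using hγ₂) fun i j => ?_
    have h := h2 y hy i.succ j.succ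
    rw [metricEq, hc, bach_eq_zero B G hW.isOpen (hW.weyl_eq_zero hκ) _ _ hy,
      hW.gForm_hodge_succ_succ hT i j hy, hW.gForm_extD_hodge_succ_succ hT i j hy,
      hW.apply_succ_succ y hy] at h
    linear_combination h
  -- As `δT = -*(d*T)`, it vanishes on the whole open set, which is what allows `d` to be applied to
  -- it below.
  have hδ : ∀ J, ∀ y ∈ V ×ˢ U, codiff B G T J y = 0 := fun J y hy => by
    rw [codiff, hodge_eq_zero (n := 4) (k := 2) (l := 2) rfl G (hω y hy), neg_zero]
  intro y hy J
  have h := h1 y hy J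
  rw [torsionEq, extD_eq_zero B hW.isOpen hδ J hy] at h
  simpa [hγ₁] using h

end IsWarpedOn

end Coord

/-! ### Coordinate frames -/

section Frames

variable {E : Type*} [NormedAddCommGroup E] [NormedSpace ℝ E]
  {H : Type*} [TopologicalSpace H] {I : ModelWithCorners ℝ E H} [I.Boundaryless]
  {M : Type*} [TopologicalSpace M] [ChartedSpace H M] {n : ℕ}

theorem mdifferentiableAt_extChartAt_symm [IsManifold I 1 M] (x : M) {y : E}
    (hy : y ∈ (extChartAt I x).target) :
    MDifferentiableAt 𝓘(ℝ, E) I (extChartAt I x).symm y :=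
  (mdifferentiableOn_extChartAt_symm y hy).mdifferentiableAt
    ((isOpen_extChartAt_target x).mem_nhds hy)

theorem isInvertible_mfderiv_extChartAt_symm [IsManifold I 1 M] (x : M) {y : E}
    (hy : y ∈ (extChartAt I x).target) :
    (mfderiv 𝓘(ℝ, E) I (extChartAt I x).symm y).IsInvertible := by
  have := isInvertible_mfderivWithin_extChartAt_symm hy
  rwa [I.range_eq_univ, mfderivWithin_univ] at this

theorem linearIndependent_coordVec [IsManifold I 1 M] (x : M) (b : Module.Basis (Fin n) ℝ E)
    {y : E} (hy : y ∈ (extChartAt I x).target) :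
    LinearIndependent ℝ fun i => coordVec I (chartAt H x) b i y := by
  have h := isInvertible_mfderiv_extChartAt_symm x hy
  exact b.linearIndependent.map' (mfderiv 𝓘(ℝ, E) I (extChartAt I x).symm y).toLinearMap
    (LinearMap.ker_eq_bot.2 h.injective)

/-- A form vanishes if its components in a chart do. -/
theorem eq_zero_of_coordForm_eq_zero [IsManifold I 1 M] {k : ℕ}
    (T : ∀ x : M, TangentSpace I x [⋀^Fin k]→ₗ[ℝ] ℝ) (x : M) (b : Module.Basis (Fin n) ℝ E)
    (h : ∀ J, coordForm I T (chartAt H x) b J (extChartAt I x x) = 0) : T x = 0 := by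
  have hy : extChartAt I x x ∈ (extChartAt I x).target := mem_extChartAt_target x
  have key : T ((extChartAt I x).symm (extChartAt I x x)) = 0 := by
    set L := mfderiv 𝓘(ℝ, E) I (extChartAt I x).symm (extChartAt I x x)
    have hL : Function.Surjective L := (isInvertible_mfderiv_extChartAt_symm x hy).surjective
    have hc : (T ((extChartAt I x).symm (extChartAt I x x))).compLinearMap L.toLinearMap = 0 :=
      Module.Basis.ext_alternating b fun J _ => h J
    ext v
    choose w hw using fun a => hL (v a)
    have h0 := congrArg (fun A => A w) hc
    rw [← funext hw]
    exact h0
  rwa [extChartAt_to_inv] at key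

/-- Coordinate frames are smooth. -/
theorem contMDiffOn_coordVec [IsManifold I ∞ M] (x : M) (b : Module.Basis (Fin n) ℝ E)
    (i : Fin n) :
    ContMDiffOn 𝓘(ℝ, E) I.tangent ∞
      (fun y => (⟨(extChartAt I x).symm y, coordVec I (chartAt H x) b i y⟩ : TangentBundle I M))
      (extChartAt I x).target := by
  have hopen := isOpen_extChartAt_target (I := I) x
  -- The frame field is the tangent map of the inverse chart applied to the constant section `b i`,
  -- and both are smooth.
  have h1 := (contMDiffOn_extChartAt_symm (I := I) (n := ∞) x).contMDiffOn_tangentMapWithin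
    (m := ∞) (by simp) hopen.uniqueMDiffOn
  have h2 : ContMDiffOn 𝓘(ℝ, E) 𝓘(ℝ, E).tangent ∞
      (fun y => (⟨y, b i⟩ : TangentBundle 𝓘(ℝ, E) E)) (extChartAt I x).target :=
    contMDiffOn_vectorSpace_iff_contDiffOn.2 contDiffOn_const
  refine (h1.comp h2 fun y hy => hy).congr fun y hy => ?_
  simp only [Function.comp_apply, tangentMapWithin, mfderivWithin_of_isOpen hopen hy]
  rfl

variable [RiemannianBundle (fun x : M => TangentSpace I x)]

omit [I.Boundaryless] in
theorem posDef_riemannianMetric (x : M) {v : Fin n → TangentSpace I x} (hv : LinearIndependent ℝ v) :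
    (Matrix.of fun i j => riemannianMetric I x (v i) (v j)).PosDef :=
  Matrix.posDef_gram_of_linearIndependent (E := TangentSpace I x) hv

theorem posDef_coordMetric [IsManifold I 1 M] (x : M) (b : Module.Basis (Fin n) ℝ E)
    {y : E} (hy : y ∈ (extChartAt I x).target) :
    (coordMetric I (riemannianMetric I) (chartAt H x) b y).PosDef :=
  posDef_riemannianMetric _ (linearIndependent_coordVec x b hy)

theorem isMetricOn_coordMetric [IsManifold I ∞ M]
    [IsContMDiffRiemannianBundle I ∞ E (fun x : M => TangentSpace I x)]
    (x : M) (b : Module.Basis (Fin n) ℝ E) :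
    Coord.IsMetricOn (coordMetric I (riemannianMetric I) (chartAt H x) b)
      (extChartAt I x).target where
  isOpen := isOpen_extChartAt_target x
  smooth i j := contMDiffOn_iff_contDiffOn.1 <|
    ContMDiffOn.inner_bundle (E := fun x : M => TangentSpace I x) (b := (extChartAt I x).symm)
      (v := coordVec I (chartAt H x) b i) (w := coordVec I (chartAt H x) b j)
      (contMDiffOn_coordVec x b i) (contMDiffOn_coordVec x b j)
  symm y _ i j := real_inner_comm (F := TangentSpace I ((extChartAt I x).symm y))
    (coordVec I (chartAt H x) b j y) (coordVec I (chartAt H x) b i y)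
  det_ne_zero _ hy := (posDef_coordMetric x b hy).det_pos.ne'

end Frames

/-! ### Product charts on the warped product -/

/-- A basis adapted to the splitting: index `0` is the `t` direction, successors are fiber
directions. -/
theorem Module.Basis.exists_prod_fin_succ {E : Type*} [AddCommGroup E] [Module ℝ E] {n : ℕ}
    (b : Module.Basis (Fin n) ℝ E) :
    ∃ B : Module.Basis (Fin (n + 1)) ℝ (ℝ × E), B 0 = (1, 0) ∧ ∀ i : Fin n, B i.succ = (0, b i) := by
  refine ⟨((Module.Basis.singleton (Fin 1) ℝ).prod b).reindex
    (finSumFinEquiv.trans (finCongr (Nat.add_comm 1 n))), ?_, fun i => ?_⟩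
  · have : (0 : Fin (n + 1)) = (finSumFinEquiv.trans (finCongr (Nat.add_comm 1 n))) (Sum.inl 0) := by
      ext; simp
    rw [this, Module.Basis.reindex_apply, Equiv.symm_apply_apply]
    simp
  · have : i.succ = (finSumFinEquiv.trans (finCongr (Nat.add_comm 1 n))) (Sum.inr i) := by
      ext; simp
    rw [this, Module.Basis.reindex_apply, Equiv.symm_apply_apply]
    simp

theorem UnitAddCircle.contMDiff_coe :
    ContMDiff 𝓘(ℝ, ℝ) 𝓘(ℝ, ℝ) ∞ (fun r : ℝ => (r : UnitAddCircle)) := by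
  intro s
  have h := UnitAddCircle.chart_coe_eventually
    (chart_mem_atlas ℝ (s : UnitAddCircle)) (mem_chart_source ℝ (s : UnitAddCircle))
  refine contMDiffAt_iff_target.2 ⟨(AddCircle.continuous_mk' 1).continuousAt, ?_⟩
  refine ContDiffAt.contMDiffAt (ContDiffAt.congr_of_eventuallyEq
    (f := fun r : ℝ => r + (chartAt ℝ (s : UnitAddCircle) (s : UnitAddCircle) - s)) ?_ h)
  exact contDiffAt_id.add contDiffAt_const

section ProductChart

variable {N : Type*} [TopologicalSpace N] [ChartedSpace (EuclideanSpace ℝ (Fin 3)) N]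
  [IsManifold (𝓡 3) ∞ N]

/-- The inverse of every chart is the projection on all of `ℝ`. The warping function in coordinates
is therefore the periodic lift of `f`, a smooth function on the whole line. -/
theorem UnitAddCircle.extChartAt_symm_apply (t : UnitAddCircle) (s : ℝ) :
    (extChartAt 𝓘(ℝ, ℝ) t).symm s = (s : UnitAddCircle) :=
  UnitAddCircle.symm_of_mem_atlas (chart_mem_atlas ℝ t) s

/-- In a product chart, `Prod.fst` after the inverse chart is the projection `ℝ → ℝ / ℤ` after
`Prod.fst`; the chain rule applied to both sides gives the claim. -/
theorem dt_mfderiv_fst_coordVec (x : UnitAddCircle × N)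
    (B : Module.Basis (Fin 4) ℝ (ℝ × EuclideanSpace ℝ (Fin 3))) (i : Fin 4)
    {y : ℝ × EuclideanSpace ℝ (Fin 3)}
    (hy : y ∈ (extChartAt (𝓘(ℝ, ℝ).prod (𝓡 3)) x).target) :
    UnitAddCircle.dt ((extChartAt (𝓘(ℝ, ℝ).prod (𝓡 3)) x).symm y).1
      (mfderiv (𝓘(ℝ, ℝ).prod (𝓡 3)) 𝓘(ℝ, ℝ) Prod.fst
        ((extChartAt (𝓘(ℝ, ℝ).prod (𝓡 3)) x).symm y)
        (coordVec (𝓘(ℝ, ℝ).prod (𝓡 3))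
          (chartAt (ModelProd ℝ (EuclideanSpace ℝ (Fin 3))) x) B i y)) = (B i).1 := by
  have hmd := mdifferentiableAt_extChartAt_symm x hy
  have hc := mfderiv_comp_apply (I'' := 𝓘(ℝ, ℝ)) y (g := Prod.fst) mdifferentiableAt_fst hmd (B i)
  have he : Prod.fst ∘ (extChartAt (𝓘(ℝ, ℝ).prod (𝓡 3)) x).symm
      = (fun r : ℝ => (r : UnitAddCircle)) ∘ Prod.fst := by
    ext z
    simp only [extChartAt_prod, Function.comp_apply, PartialEquiv.prod_symm, PartialEquiv.prod_coe,
      UnitAddCircle.extChartAt_symm_apply]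
  have hc2 := mfderiv_comp_apply (I := 𝓘(ℝ, ℝ × EuclideanSpace ℝ (Fin 3))) (I'' := 𝓘(ℝ, ℝ))
    (I' := 𝓘(ℝ, ℝ)) y
    (g := (fun r : ℝ => (r : UnitAddCircle))) (f := Prod.fst)
    (UnitAddCircle.contMDiff_coe.mdifferentiable (by simp) _)
    differentiableAt_fst.mdifferentiableAt (B i)
  rw [← he, hc, mfderiv_eq_fderiv, fderiv_fst] at hc2
  exact hc2.trans (UnitAddCircle.dt_mfderiv_coe y.1 (B i).1)

theorem mfderiv_snd_coordVec (x : UnitAddCircle × N)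
    (B : Module.Basis (Fin 4) ℝ (ℝ × EuclideanSpace ℝ (Fin 3))) (i : Fin 4)
    {y : ℝ × EuclideanSpace ℝ (Fin 3)}
    (hy : y ∈ (extChartAt (𝓘(ℝ, ℝ).prod (𝓡 3)) x).target) :
    (mfderiv (𝓘(ℝ, ℝ).prod (𝓡 3)) (𝓡 3) Prod.snd
        ((extChartAt (𝓘(ℝ, ℝ).prod (𝓡 3)) x).symm y)
        (coordVec (𝓘(ℝ, ℝ).prod (𝓡 3))
          (chartAt (ModelProd ℝ (EuclideanSpace ℝ (Fin 3))) x) B i y)) =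
      mfderiv 𝓘(ℝ, EuclideanSpace ℝ (Fin 3)) (𝓡 3) (extChartAt (𝓡 3) x.2).symm y.2 (B i).2 := by
  have hmd := mdifferentiableAt_extChartAt_symm x hy
  have hc := mfderiv_comp_apply (I'' := 𝓡 3) y (g := Prod.snd) mdifferentiableAt_snd hmd (B i)
  have he : Prod.snd ∘ (extChartAt (𝓘(ℝ, ℝ).prod (𝓡 3)) x).symm
      = (extChartAt (𝓡 3) x.2).symm ∘ Prod.snd := by
    ext z
    simp only [extChartAt_prod, Function.comp_apply, PartialEquiv.prod_symm, PartialEquiv.prod_coe]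
  have hy2 : y.2 ∈ (extChartAt (𝓡 3) x.2).target := by
    rw [extChartAt_prod] at hy
    exact hy.2
  have hc2 := mfderiv_comp_apply (I := 𝓘(ℝ, ℝ × EuclideanSpace ℝ (Fin 3))) (I'' := 𝓡 3)
    (I' := 𝓘(ℝ, EuclideanSpace ℝ (Fin 3))) y
    (g := (extChartAt (𝓡 3) x.2).symm) (f := Prod.snd)
    (mdifferentiableAt_extChartAt_symm x.2 hy2)
    differentiableAt_snd.mdifferentiableAt (B i)
  rw [← he, hc, mfderiv_eq_fderiv, fderiv_snd] at hc2
  exact hc2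

omit [IsManifold (𝓡 3) ∞ N] in
theorem extChartAt_warped_target (x : UnitAddCircle × N) :
    (extChartAt (𝓘(ℝ, ℝ).prod (𝓡 3)) x).target
      = (extChartAt 𝓘(ℝ, ℝ) x.1).target ×ˢ (extChartAt (𝓡 3) x.2).target := by
  rw [extChartAt_prod]
  rfl

variable [RiemannianBundle (fun x : N => TangentSpace (𝓡 3) x)]

/-- In a product chart, the warped product metric has the standard form. -/
theorem isWarpedOn_coordMetric
    [IsContMDiffRiemannianBundle (𝓡 3) ∞ (EuclideanSpace ℝ (Fin 3))
      (fun x : N => TangentSpace (𝓡 3) x)]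
    {f : UnitAddCircle → ℝ} (hf : ContMDiff 𝓘(ℝ, ℝ) 𝓘(ℝ, ℝ) ∞ f) (hfpos : ∀ t, 0 < f t)
    (x : UnitAddCircle × N) (b : Module.Basis (Fin 3) ℝ (EuclideanSpace ℝ (Fin 3)))
    (B : Module.Basis (Fin 4) ℝ (ℝ × EuclideanSpace ℝ (Fin 3))) (hB0 : B 0 = (1, 0))
    (hB : ∀ i : Fin 3, B i.succ = (0, b i)) :
    Coord.IsWarpedOn b
      (coordMetric (𝓡 3) (riemannianMetric (M := N) (𝓡 3))
        (chartAt (EuclideanSpace ℝ (Fin 3)) x.2) b)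
      (extChartAt (𝓡 3) x.2).target (fun s : ℝ => f (s : UnitAddCircle))
      (extChartAt 𝓘(ℝ, ℝ) x.1).target B
      (coordMetric (𝓘(ℝ, ℝ).prod (𝓡 3)) (warpedMetric (N := N) f)
        (chartAt (ModelProd ℝ (EuclideanSpace ℝ (Fin 3))) x) B) := by
  -- One formula for all components, from which the four blocks follow on inserting the adapted
  -- basis.
  have key : ∀ y ∈ (extChartAt 𝓘(ℝ, ℝ) x.1).target ×ˢ (extChartAt (𝓡 3) x.2).target,
      ∀ i j, coordMetric (𝓘(ℝ, ℝ).prod (𝓡 3)) (warpedMetric (N := N) f)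
        (chartAt (ModelProd ℝ (EuclideanSpace ℝ (Fin 3))) x) B y i j = (B i).1 * (B j).1
        + f (y.1 : UnitAddCircle) ^ 2 * riemannianMetric (𝓡 3) ((extChartAt (𝓡 3) x.2).symm y.2)
          (mfderiv 𝓘(ℝ, EuclideanSpace ℝ (Fin 3)) (𝓡 3) (extChartAt (𝓡 3) x.2).symm y.2 (B i).2)
          (mfderiv 𝓘(ℝ, EuclideanSpace ℝ (Fin 3)) (𝓡 3) (extChartAt (𝓡 3) x.2).symm y.2
            (B j).2) := by
    intro y hy i j
    rw [← extChartAt_warped_target] at hy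
    rw [← mfderiv_snd_coordVec x B i hy, ← mfderiv_snd_coordVec x B j hy,
      ← dt_mfderiv_fst_coordVec x B i hy, ← dt_mfderiv_fst_coordVec x B j hy,
      ← UnitAddCircle.extChartAt_symm_apply x.1 y.1]
    rfl
  have h0 : ∀ z, mfderiv 𝓘(ℝ, EuclideanSpace ℝ (Fin 3)) (𝓡 3) (extChartAt (𝓡 3) x.2).symm z
      (B 0).2 = 0 := fun z => by
    rw [hB0]
    exact map_zero _
  have h00 : (B 0).1 = 1 := by rw [hB0]
  have h1 : ∀ i : Fin 3, (B i.succ).1 = 0 := fun i => by rw [hB]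
  refine ⟨isMetricOn_coordMetric x.2 b, isOpen_extChartAt_target x.1,
    contMDiff_iff_contDiff.1 (hf.comp UnitAddCircle.contMDiff_coe), fun t => hfpos _, hB0, hB,
    fun y hy => ?_, fun y hy i => ?_, fun y hy i => ?_, fun y hy i j => ?_⟩
  · rw [key y hy, h0, h00, LinearMap.map_zero, mul_zero, mul_one, add_zero]
  · rw [key y hy, h0, LinearMap.map_zero, LinearMap.zero_apply, h1, mul_zero, mul_zero, add_zero]
  · rw [key y hy, h0, LinearMap.map_zero, h1, zero_mul, mul_zero, add_zero]
  · rw [key y hy, hB, hB, mul_zero, zero_add]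
    rfl

/-- The differential of the projection to `N` kills `∂_t`, and an alternating form vanishes when one
argument is zero. -/
theorem coordForm_warpedTorsion_eq_zero (o : ∀ x : N, Orientation ℝ (TangentSpace (𝓡 3) x) (Fin 3))
    (τ : UnitAddCircle × N → ℝ) (x : UnitAddCircle × N)
    (B : Module.Basis (Fin 4) ℝ (ℝ × EuclideanSpace ℝ (Fin 3))) (hB0 : B 0 = (1, 0))
    {y : ℝ × EuclideanSpace ℝ (Fin 3)}
    (hy : y ∈ (extChartAt (𝓘(ℝ, ℝ).prod (𝓡 3)) x).target) (J : Fin 3 → Fin 4)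
    (hJ : ∃ a, J a = 0) :
    coordForm (𝓘(ℝ, ℝ).prod (𝓡 3)) (warpedTorsion o τ)
      (chartAt (ModelProd ℝ (EuclideanSpace ℝ (Fin 3))) x) B J y = 0 := by
  obtain ⟨a, ha⟩ := hJ
  have h := mfderiv_snd_coordVec x B (J a) hy
  refine mul_eq_zero_of_right _ (AlternatingMap.map_coord_zero
    (dvol o ((extChartAt (𝓘(ℝ, ℝ).prod (𝓡 3)) x).symm y).2) a (h.trans ?_))
  rw [ha, hB0]
  exact map_zero _

end ProductChart

/-! ### The theorem, by reduction to a product chart around each point -/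

theorem mainTheorem11 {N : Type*} [TopologicalSpace N]
    [ChartedSpace (EuclideanSpace ℝ (Fin 3)) N] [IsManifold (𝓡 3) ∞ N]
    [T2Space N] [CompactSpace N]
    [RiemannianBundle (fun x : N => TangentSpace (𝓡 3) x)]
    [IsContMDiffRiemannianBundle (𝓡 3) ∞ (EuclideanSpace ℝ (Fin 3))
      (fun x : N => TangentSpace (𝓡 3) x)]
    (o : ∀ x : N, Orientation ℝ (TangentSpace (𝓡 3) x) (Fin 3))
    (ho : IsManifoldOrientation o)
    (hN : HasConstantCurvature (𝓡 3) 3 (riemannianMetric (M := N) (𝓡 3)))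
    (f : UnitAddCircle → ℝ) (hf : ContMDiff 𝓘(ℝ, ℝ) 𝓘(ℝ, ℝ) ∞ f) (hfpos : ∀ t, 0 < f t)
    (τ : UnitAddCircle × N → ℝ) (hτ : ContMDiff (𝓘(ℝ, ℝ).prod (𝓡 3)) 𝓘(ℝ, ℝ) ∞ τ)
    (α β γ₁ γ₂ : ℝ) (hα : 0 < α) (hβ : 0 < β) (hγ₁ : 0 < γ₁) (hγ₂ : 0 < γ₂)
    (hsol : SolvesEquationsOfMotion (𝓘(ℝ, ℝ).prod (𝓡 3)) α β γ₁ γ₂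
      (warpedMetric (N := N) f) (warpedTorsion o τ)) :
    ∀ x : UnitAddCircle × N, warpedTorsion o τ x = 0 := by
  intro x
  obtain ⟨κ, hκ⟩ := hN
  let b := (EuclideanSpace.basisFun (Fin 3) ℝ).toBasis
  obtain ⟨B, hB0, hB⟩ := b.exists_prod_fin_succ
  -- The chart of `S¹ × N` at `x` is a product of charts, so the coordinate argument applies on its
  -- whole target, which contains the image of `x`.
  have hW := isWarpedOn_coordMetric hf hfpos x b B hB0 hB
  have hsol' := hsol _ (IsManifold.chart_mem_maximalAtlas x) B
  have htarget := extChartAt_warped_target x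
  have h := hW.torsion_eq_zero (κ := κ) (α := α) (β := β)
    (T := coordForm (𝓘(ℝ, ℝ).prod (𝓡 3)) (warpedTorsion o τ)
      (chartAt (ModelProd ℝ (EuclideanSpace ℝ (Fin 3))) x) B)
    (fun y hy => coordForm_warpedTorsion_eq_zero o τ x B hB0 (htarget ▸ hy))
    (fun z hz => posDef_coordMetric x.2 b hz)
    (fun z hz => (hW.fiber.riem_of_sectional b hz
      (hκ _ (IsManifold.chart_mem_maximalAtlas x.2) b z hz)))
    hγ₁.ne' hγ₂.ne'
    (fun y hy => (hsol' y (htarget ▸ hy)).1) (fun y hy => (hsol' y (htarget ▸ hy)).2)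
  exact eq_zero_of_coordForm_eq_zero _ x B fun J =>
    h _ (htarget ▸ mem_extChartAt_target x) J
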